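/- **Setup.** Let $(\mathcal X,d)$ be a separable metric space and $P$ a probability distribution on $\mathcal X\times\{\pm1\}$ with marginal $\mu$ on $\mathcal X$. Let $\eta(x)=\mathbb E(Y\mid X=x)\in[-1,1]$ be a fixed version of the conditional expectation for $(X,Y)\sim P$, and write $\eta(S)=\frac1{\mu(S)}\int_S\eta\,d\mu$ if $\mu(S)>0$. Let $g^*:\mathcal X\to\{\pm1\}$ be a Bayes-optimal classifier: $g^*(x)=\mathrm{sign}(\eta(x))$ whenever $\eta(x)\ne0$. Let $B(x,r)$ be the closed ball of radius $r\ge 0$ about $x$, and let $\mathrm{supp}(\mu)=\{x:\mu(B(x,r))>0 \text{ for all } r>0\}$. **Advantage.** For $0<p\le1$ let $r_p(x)=\inf\{r\ge0:\mu(B(x,r))\ge p\}$. For $0<p\le 1$ and $\gamma>0$, the point $x$ is $(p,\gamma)$-salient if $r_p(x)$ is finite and, for $s=+1$ or for $s=-1$: $s\,\eta(x)>0$; $s\,\eta(B(x,r))>0$ for all $r\in[0,r_p(x))$ with $\mu(B(x,r))>0$; and $s\,\eta(B(x,r_p(x)))\ge\gamma$. Put $\mathrm{adv}(x)=\sup\{p\gamma^2: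 x\text{ is }(p,\gamma)\text{-salient}\}$ if $\eta(x)\neq0$ (with $\sup\emptyset=0$), and $\mathrm{adv}(x)=0$ if $\eta(x)=0$. **Algorithm.** Let $c_1>0$, let $d_0$ be the VC dimension (assumed finite) of the family of all closed balls of $(\mathcal X,d)$, and let $0<\delta<1$. Given training points $(x_1,y_1),\dots,(x_n,y_n)$ and a query $x\in\mathcal X$, let $B_k(x)$ be the smallest closed ball centered at $x$ that contains exactly $k$ training points (values of $k$ for which there is none are skipped), and let $\eta_n(B)$ be the average of the labels $y_i$ over the $x_i\in B$. Take the smallest $0<k\le n$ with $$|\eta_n(B_k(x))|>\Delta(n,k,\delta)=c_1\sqrt{\frac{d_0\log n+\log(1/\delta)}{k}}$$ and set $g_n(x)=\mathrm{sign}(\eta_n(B_k(x)))$; if there is no such $k$, set $g_n(x)=$ "?". **Theorem (uniform convergence rate).** There is an absolute constant $c_0>0$ such that for every $c_1\ge c_0$, every integer $d_0\ge0$ and every $\delta_1<1$ there is a constant $C>0$, depending only on $c_1$, $d_0$ and $\delta_1$, for which the following holds. Let $(\mathcal X,d)$ be any separable metric space whose family of closed balls has VC dimension $d_0$, let $P$,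 $\eta$, $g^*$ be as above, let $0<\delta\le\delta_1$, and let $g_n$ be the classifier above, built with the constant $c_1$ and the parameter $\delta$ from $n$ training points drawn i.i.d. from $P$. Then with probability at least $1-\delta$ the following holds simultaneously for all $x\in\mathrm{supp}(\mu)$ with $\mathrm{adv}(x)>0$: if $$n\ \ge\ \frac{C}{\mathrm{adv}(x)}\max\Bigl(\log\frac1{\mathrm{adv}(x)},\ \log\frac1\delta\Bigr)$$ then $g_n(x)=g^*(x)$. -/

import Mathlib

open MeasureTheory Set

noncomputable section

namespace AKNN

/-! ### VC dimension of the family of closed balls -/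

/-- The family `F` of subsets of `X` shatters the finite set `S`: every subset of `S` is cut out of
`S` by a member of `F`. -/
def Shatters {X : Type*} (F : Set (Set X)) (S : Finset X) : Prop :=
  ∀ T : Finset X, T ⊆ S → ∃ A ∈ F, ∀ z ∈ S, z ∈ A ↔ z ∈ T

/-- The VC dimension of a family of sets: the supremum of the sizes of the shattered sets. -/
def vcDim {X : Type*} (F : Set (Set X)) : ℕ∞ :=
  ⨆ (S : Finset X) (_ : Shatters F S), (S.card : ℕ∞)

/-- The family of all closed balls `B(x, r)` with `r ≥ 0`. -/
def ballFamily (X : Type*) [MetricSpace X] : Set (Set X) :=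
  {A | ∃ (x : X) (r : ℝ), 0 ≤ r ∧ A = Metric.closedBall x r}

/-! ### The distribution: bias, Bayes rule, advantage

Labels are elements of `ℤˣ = {1, -1}`. -/

/-- `η` is (a version, defined at every point and with values in `[-1, 1]`, of) the conditional
expectation `η(x) = E(Y | X = x)` for `(X, Y)` drawn from `P`. -/
structure IsBias {X : Type*} [MeasurableSpace X] (P : Measure (X × ℤˣ)) (η : X → ℝ) : Prop where
  measurable : Measurable η
  mem_Icc : ∀ x, η x ∈ Icc (-1 : ℝ) 1
  setIntegral_eq : ∀ S : Set X, MeasurableSet S →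
    ∫ x in S, η x ∂P.fst = ∫ z in Prod.fst ⁻¹' S, ((z.2 : ℤ) : ℝ) ∂P

/-- The sign of a nonzero real number, as a label. -/
def signLabel (t : ℝ) : ℤˣ := if 0 < t then 1 else -1

/-- `g` is a Bayes-optimal classifier: it is the sign of `η` where `η ≠ 0`, and arbitrary
elsewhere. -/
def IsBayesOptimal {X : Type*} (η : X → ℝ) (g : X → ℤˣ) : Prop :=
  ∀ x, η x ≠ 0 → g x = signLabel (η x)

/-- The bias `η(S) = E(Y | X ∈ S)` of a set `S` of positive mass. -/
def setBias {X : Type*} [MeasurableSpace X] (μ : Measure X) (η : X → ℝ) (S : Set X) : ℝ :=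
  (∫ x in S, η x ∂μ) / μ.real S

/-- The probability-radius `r_p(x) = inf {r ≥ 0 : μ(B(x, r)) ≥ p}`. -/
def massRadius {X : Type*} [MetricSpace X] [MeasurableSpace X] (μ : Measure X) (p : ℝ) (x : X) :
    ℝ :=
  sInf {r : ℝ | 0 ≤ r ∧ p ≤ μ.real (Metric.closedBall x r)}

/-- The point `x` is `(p, γ)`-salient, for `0 < p ≤ 1` and `γ > 0`.
The second clause says that `r_p(x)` exists (it can only fail for `p = 1`).
The sign condition on the biases of the smaller balls concerns the balls that have a bias, that is,
those of positive mass; for `x` in the support of `μ` this only leaves out `B(x, 0) = {x}` when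
`x` is not an atom. -/
def IsSalient {X : Type*} [MetricSpace X] [MeasurableSpace X] (μ : Measure X) (η : X → ℝ)
    (p γ : ℝ) (x : X) : Prop :=
  (0 < p ∧ p ≤ 1 ∧ 0 < γ) ∧
  (∃ r : ℝ, 0 ≤ r ∧ p ≤ μ.real (Metric.closedBall x r)) ∧
  ∃ s : ℝ, (s = 1 ∨ s = -1) ∧ 0 < s * η x ∧
    (∀ r : ℝ, 0 ≤ r → r < massRadius μ p x → 0 < μ (Metric.closedBall x r) →
      0 < s * setBias μ η (Metric.closedBall x r)) ∧
    γ ≤ s * setBias μ η (Metric.closedBall x (massRadius μ p x))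

open Classical in
/-- The advantage `adv(x)`; it is `0` when `x` is not salient for any pair (all the values `p γ²`
lie in `[0, 1]`, so the supremum is a genuine one). -/
def adv {X : Type*} [MetricSpace X] [MeasurableSpace X] (μ : Measure X) (η : X → ℝ) (x : X) : ℝ :=
  if η x = 0 then 0 else sSup {a : ℝ | ∃ p γ : ℝ, IsSalient μ η p γ x ∧ a = p * γ ^ 2}

/-! ### The adaptive nearest neighbor classifier -/

/-- The indices `i` of the training points `x_i` in `S`. -/
def indicesIn {X : Type*} {n : ℕ} (t : Fin n → X × ℤˣ) (S : Set X) : Finset (Fin n) :=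
  open Classical in Finset.univ.filter (fun i => (t i).1 ∈ S)

/-- The empirical count `#_n(S)`. -/
def empCount {X : Type*} {n : ℕ} (t : Fin n → X × ℤˣ) (S : Set X) : ℕ := (indicesIn t S).card

/-- The empirical bias `η_n(S)`, for `#_n(S) ≠ 0`. -/
def empBias {X : Type*} {n : ℕ} (t : Fin n → X × ℤˣ) (S : Set X) : ℝ :=
  (∑ i ∈ indicesIn t S, (((t i).2 : ℤ) : ℝ)) / (empCount t S : ℝ)

/-- The radii `r ≥ 0` for which `B(x, r)` contains exactly `k` training points. -/
def kRadii {X : Type*} [MetricSpace X] {n : ℕ} (t : Fin n → X × ℤˣ) (x : X) (k : ℕ) : Set ℝ :=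
  {r : ℝ | 0 ≤ r ∧ empCount t (Metric.closedBall x r) = k}

/-- `B_k(x)`, the smallest ball centered at `x` that contains exactly `k` training points; it is
defined when `kRadii t x k` is nonempty. -/
def kBall {X : Type*} [MetricSpace X] {n : ℕ} (t : Fin n → X × ℤˣ) (x : X) (k : ℕ) : Set X :=
  Metric.closedBall x (sInf (kRadii t x k))

/-- The confidence width `Δ(n, k, δ) = c₁ √((d₀ log n + log (1/δ)) / k)`. -/
def width (c₁ : ℝ) (d₀ n k : ℕ) (δ : ℝ) : ℝ :=
  c₁ * √((d₀ * Real.log n + Real.log (1 / δ)) / k)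

/-- The `k` with `0 < k ≤ n` for which `B_k(x)` is defined and has a significant bias. -/
def significant {X : Type*} [MetricSpace X] (c₁ : ℝ) (d₀ : ℕ) (δ : ℝ) {n : ℕ}
    (t : Fin n → X × ℤˣ) (x : X) : Set ℕ :=
  {k : ℕ | 0 < k ∧ k ≤ n ∧ (kRadii t x k).Nonempty ∧
    width c₁ d₀ n k δ < |empBias t (kBall t x k)|}

open Classical in
/-- The classifier `g_n` produced from the training set `t`; the value `none` is the label "?". -/
def classifier {X : Type*} [MetricSpace X] (c₁ : ℝ) (d₀ : ℕ) (δ : ℝ) {n : ℕ}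
    (t : Fin n → X × ℤˣ) (x : X) : Option ℤˣ :=
  if (significant c₁ d₀ δ t x).Nonempty then
    some (signLabel (empBias t (kBall t x (sInf (significant c₁ d₀ δ t x)))))
  else none

end AKNN

end

open MeasureTheory Set Filter Topology

noncomputable section

namespace AKNN

/-! Put L = K (d₀ log n + log (1/δ)), where K is a constant, equal to 1 when d₀ > 0. A single event
of probability at least 1 - δ controls, for all closed balls B and both labels s at once, the number
k of training points in B with label s: if M is its mean, then k - M = O(√(kL)) and M - k =
O(√(ML)). This relative VC bound, `exists_event_isTypical`, comes from a ghost sample, random swaps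
of the two samples, a tail bound for Rademacher sums and Sauer's lemma. The rest is deterministic on
that event.

Take a salient pair (p, γ) for x with p γ² more than half the advantage, and let s be its sign.
Balls of radius below r_p(x) do not favour -s in expectation, so they cannot look significantly
biased towards -s (`neg_labelSum_le_of_typical`); this is where c₁ ≥ 32 is used. In the ball of
radius r_p(x), of mass m ≥ p, the signal is at least γ n m, while noise and threshold are of order
√(n m L), so the ball is significant once n p γ² exceeds a constant times L
(`lt_labelSum_of_typical`). Hence the first significant ball votes for s (`classifier_eq_some`), the
sign of η(x). Finally `sample_size_sufficient` removes the log n hidden in L.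

When d₀ = 0 the quantity log (1/δ) may be too small for the VC bound; but then X has at most one
point and all balls about it coincide. -/

/-! ### Signed sums -/

/-- The real number `1` or `-1` attached to a Boolean. -/
def boolSign (b : Bool) : ℝ := if b then -1 else 1

/-- The sum over sign patterns factorizes into terms 2 cosh (l aᵢ), and cosh y ≤ exp (y²/2). -/
theorem sum_exp_signed_le {n : ℕ} (a : Fin n → ℝ) (l : ℝ) :
    ∑ σ : Fin n → Bool, Real.exp (l * ∑ i, boolSign (σ i) * a i) ≤
      2 ^ n * Real.exp (l ^ 2 * (∑ i, a i ^ 2) / 2) := by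
  have h1 : ∀ σ : Fin n → Bool, Real.exp (l * ∑ i, boolSign (σ i) * a i) =
      ∏ i, Real.exp (l * (boolSign (σ i) * a i)) := by
    intro σ
    rw [Finset.mul_sum, Real.exp_sum]
  have h2 : ∑ σ : Fin n → Bool, Real.exp (l * ∑ i, boolSign (σ i) * a i) =
      ∏ i, (2 * Real.cosh (l * a i)) := by
    simp_rw [h1]
    rw [← Fintype.piFinset_univ,
      ← Finset.prod_univ_sum (fun _ => Finset.univ)
        (fun i b => Real.exp (l * (boolSign b * a i)))]
    refine Finset.prod_congr rfl fun i _ => ?_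
    rw [Fintype.sum_bool, Real.cosh_eq]
    simp only [boolSign, if_true, Bool.false_eq_true, if_false]
    ring_nf
  rw [h2, Finset.prod_mul_distrib, Finset.prod_const, Finset.card_univ, Fintype.card_fin]
  refine mul_le_mul_of_nonneg_left ?_ (by positivity)
  have h3 : Real.exp (l ^ 2 * (∑ i, a i ^ 2) / 2) = ∏ i, Real.exp ((l * a i) ^ 2 / 2) := by
    rw [← Real.exp_sum, Finset.mul_sum, Finset.sum_div]
    simp_rw [mul_pow]
  rw [h3]
  exact Finset.prod_le_prod (fun i _ => (Real.cosh_pos _).le)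
    fun i _ => Real.cosh_le_exp_half_sq _

open Classical in
theorem card_lt_signed_le {n : ℕ} (a : Fin n → ℝ) {V τ : ℝ} (hV : 0 < V)
    (ha : ∑ i, a i ^ 2 ≤ V) (hτ : 0 < τ) :
    ((Finset.univ.filter fun σ : Fin n → Bool => τ < ∑ i, boolSign (σ i) * a i).card : ℝ) *
      Real.exp (τ ^ 2 / (2 * V)) ≤ 2 ^ n := by
  -- This Chernoff parameter minimizes l² V / 2 - l τ.
  set l := τ / V with hl
  have hlp : 0 < l := div_pos hτ hV
  have h1 : ((Finset.univ.filter fun σ : Fin n → Bool =>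
      τ < ∑ i, boolSign (σ i) * a i).card : ℝ) * Real.exp (l * τ) ≤
      2 ^ n * Real.exp (l ^ 2 * V / 2) := by
    calc _ = ∑ σ ∈ Finset.univ.filter (fun σ : Fin n → Bool =>
          τ < ∑ i, boolSign (σ i) * a i), Real.exp (l * τ) := by
            rw [Finset.sum_const, nsmul_eq_mul]
      _ ≤ ∑ σ ∈ Finset.univ.filter (fun σ : Fin n → Bool =>
          τ < ∑ i, boolSign (σ i) * a i), Real.exp (l * ∑ i, boolSign (σ i) * a i) := by
            refine Finset.sum_le_sum fun σ hσ => ?_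
            rw [Finset.mem_filter] at hσ
            have := hσ.2.le
            gcongr
      _ ≤ ∑ σ : Fin n → Bool, Real.exp (l * ∑ i, boolSign (σ i) * a i) :=
            Finset.sum_le_sum_of_subset_of_nonneg (Finset.subset_univ _)
              fun _ _ _ => (Real.exp_pos _).le
      _ ≤ _ := sum_exp_signed_le a l
      _ ≤ _ := by gcongr
  have h2 : Real.exp (l * τ) = Real.exp (τ ^ 2 / (2 * V)) * Real.exp (l ^ 2 * V / 2) := by
    rw [← Real.exp_add, hl]
    congr 1
    field_simp
    ring
  rw [h2, ← mul_assoc] at h1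
  exact le_of_mul_le_mul_right h1 (Real.exp_pos _)

open Classical in
theorem card_lt_abs_signed_le {n : ℕ} (a : Fin n → ℝ) {V τ : ℝ} (hV : 0 < V)
    (ha : ∑ i, a i ^ 2 ≤ V) (hτ : 0 < τ) :
    ((Finset.univ.filter fun σ : Fin n → Bool => τ < |∑ i, boolSign (σ i) * a i|).card : ℝ) ≤
      2 ^ n * (2 * Real.exp (-(τ ^ 2 / (2 * V)))) := by
  have h1 := card_lt_signed_le a hV ha hτ
  have h2 := card_lt_signed_le (fun i => -a i) hV (by simpa using ha) hτ
  have h3 : (Finset.univ.filter fun σ : Fin n → Bool => τ < |∑ i, boolSign (σ i) * a i|) ⊆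
      (Finset.univ.filter fun σ : Fin n → Bool => τ < ∑ i, boolSign (σ i) * a i) ∪
      (Finset.univ.filter fun σ : Fin n → Bool => τ < ∑ i, boolSign (σ i) * -a i) := by
    intro σ hσ
    simp only [Finset.mem_union, Finset.mem_filter, Finset.mem_univ, true_and, mul_neg,
      Finset.sum_neg_distrib] at hσ ⊢
    exact lt_abs.1 hσ
  have h4 : ((Finset.univ.filter fun σ : Fin n → Bool =>
      τ < |∑ i, boolSign (σ i) * a i|).card : ℝ) ≤ _ :=
    Nat.cast_le.2 ((Finset.card_le_card h3).trans (Finset.card_union_le _ _))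
  push_cast at h4
  rw [Real.exp_neg]
  have hE := Real.exp_pos (τ ^ 2 / (2 * V))
  rw [← le_div_iff₀ hE] at h1 h2
  calc _ ≤ _ := h4
    _ ≤ _ := add_le_add h1 h2
    _ = _ := by ring

/-! ### Sauer's lemma -/

theorem sum_choose_le (N d : ℕ) : ∑ k ∈ Finset.Iic d, N.choose k ≤ (N + 1) ^ d := by
  rw [add_pow, ← Nat.range_succ_eq_Iic]
  refine Finset.sum_le_sum fun k hk => ?_
  rw [one_pow, mul_one]
  calc N.choose k ≤ N ^ k := Nat.choose_le_pow _ _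
    _ ≤ N ^ k * d.choose k :=
      Nat.le_mul_of_pos_right _ (Nat.choose_pos (Finset.mem_range_succ_iff.1 hk))

/-- The number of traces of a family of finite VC dimension on a finite sequence of points. -/
theorem ncard_traces_le {X α : Type*} [Fintype α] {F : Set (Set X)} {d : ℕ}
    (hF : vcDim F ≤ d) (q : α → X) :
    ((fun A : Set X => q ⁻¹' A) '' F).ncard ≤ (Fintype.card α + 1) ^ d := by
  classical
  -- The traces are recorded as sets of indices, so that the Sauer–Shelah lemma for finset families
  -- applies.
  set 𝒜 : Finset (Finset α) :=
    Finset.univ.filter fun T => ∃ A ∈ F, T = Finset.univ.filter fun i => q i ∈ A with h𝒜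
  have h1 : ((fun A : Set X => q ⁻¹' A) '' F).ncard ≤ 𝒜.card := by
    rw [← Set.ncard_coe_finset]
    refine (Set.ncard_le_ncard (t := (fun T : Finset α => (T : Set α)) '' (𝒜 : Set (Finset α)))
      ?_ (Set.toFinite _)).trans (Set.ncard_image_le (Set.toFinite _))
    rintro _ ⟨A, hA, rfl⟩
    refine ⟨Finset.univ.filter fun i => q i ∈ A, ?_, ?_⟩
    · simp only [h𝒜, Finset.coe_filter, Finset.mem_univ, true_and, Set.mem_ofPred_eq]
      exact ⟨A, hA, rfl⟩
    · ext i; simp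
  have h2 : 𝒜.vcDim ≤ d := by
    refine Finset.sup_le fun S hS => ?_
    rw [Finset.mem_shatterer] at hS
    have hcut : ∀ T ⊆ S, ∃ A ∈ F, ∀ i ∈ S, q i ∈ A ↔ i ∈ T := by
      intro T hT
      obtain ⟨u, hu, huT⟩ := hS hT
      simp only [h𝒜, Finset.mem_filter, Finset.mem_univ, true_and] at hu
      obtain ⟨A, hA, rfl⟩ := hu
      refine ⟨A, hA, fun i hi => ?_⟩
      rw [← huT]
      simp [hi]
    -- Indices of one and the same point cannot be separated, so a shattered index set maps to
    -- equally many points.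
    have hinj : Set.InjOn q S := by
      intro i hi j hj hij
      obtain ⟨A, -, hA⟩ := hcut {i} (by simpa using hi)
      have h := (hA j hj).1 (hij ▸ (hA i hi).2 (Finset.mem_singleton_self i))
      exact (Finset.mem_singleton.1 h).symm
    have hsh : Shatters F (S.image q) := by
      intro T hT
      obtain ⟨A, hAF, hA⟩ := hcut (S.filter fun i => q i ∈ T) (Finset.filter_subset _ _)
      refine ⟨A, hAF, fun z hz => ?_⟩
      obtain ⟨i, hi, rfl⟩ := Finset.mem_image.1 hz
      rw [hA i hi, Finset.mem_filter]
      exact ⟨fun h => h.2, fun h => ⟨hi, h⟩⟩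
    have h3 : ((S.image q).card : ℕ∞) ≤ vcDim F :=
      le_iSup₂ (f := fun (S : Finset X) (_ : Shatters F S) => (S.card : ℕ∞)) _ hsh
    rw [Finset.card_image_of_injOn hinj] at h3
    exact_mod_cast h3.trans hF
  calc _ ≤ 𝒜.card := h1
    _ ≤ 𝒜.shatterer.card := Finset.card_le_card_shatterer _
    _ ≤ ∑ k ∈ Finset.Iic 𝒜.vcDim, (Fintype.card α).choose k :=
      Finset.card_shatterer_le_sum_vcDim
    _ ≤ ∑ k ∈ Finset.Iic d, (Fintype.card α).choose k :=
      Finset.sum_le_sum_of_subset (Finset.Iic_subset_Iic.2 h2)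
    _ ≤ _ := sum_choose_le _ _

/-! ### Relative deviations of the empirical counts of a family of sets -/

/-- The number of points of a sample in a set, as a real number. -/
def hits {Z : Type*} {n : ℕ} (A : Set Z) (t : Fin n → Z) : ℝ := ∑ i, A.indicator 1 (t i)

theorem measurable_hits {Z : Type*} [MeasurableSpace Z] {n : ℕ} {A : Set Z}
    (hA : MeasurableSet A) : Measurable (hits A : (Fin n → Z) → ℝ) := by
  unfold hits
  have h : Measurable (A.indicator (1 : Z → ℝ)) := measurable_one.indicator hA
  fun_prop

theorem hits_nonneg {Z : Type*} {n : ℕ} (A : Set Z) (t : Fin n → Z) : 0 ≤ hits A t :=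
  Finset.sum_nonneg fun _ _ => Set.indicator_nonneg (fun _ _ => zero_le_one) _

open ProbabilityTheory in
-- Chebyshev's inequality, the variance being at most n P(A). The summand 1 keeps the threshold
-- positive when P(A) = 0.
theorem half_le_measure_abs_hits_sub_lt {Z : Type*} [MeasurableSpace Z] (P : Measure Z)
    [IsProbabilityMeasure P] {n : ℕ} {A : Set Z} (hA : MeasurableSet A) :
    1 / 2 ≤ Measure.pi (fun _ : Fin n => P)
      {t | |hits A t - n * P.real A| < √(2 * (n * P.real A + 1))} := by
  set Q := Measure.pi (fun _ : Fin n => P)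
  set f : Z → ℝ := A.indicator 1
  have hf : Measurable f := measurable_one.indicator hA
  have hf01 : ∀ z, f z = 0 ∨ f z = 1 := by
    intro z
    by_cases hz : z ∈ A <;> simp [f, hz]
  have hfL : MemLp f 2 P := by
    refine MemLp.of_bound hf.aestronglyMeasurable 1 (ae_of_all _ fun z => ?_)
    rcases hf01 z with h | h <;> simp [h]
  have hint : ∫ z, f z ∂P = P.real A := by
    simp [f, integral_indicator_one hA]
  have hvar : Var[f; P] ≤ P.real A := by
    refine (variance_le_expectation_sq hf.aestronglyMeasurable).trans_eq ?_
    rw [← hint]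
    refine integral_congr_ae (ae_of_all _ fun z => ?_)
    rcases hf01 z with h | h <;> simp [h]
  have hsum : (hits A : (Fin n → Z) → ℝ) = ∑ i, fun ω => f (ω i) := by
    ext t; simp [hits, f]
  have hmp := measurePreserving_eval (fun _ : Fin n => P)
  have hL : ∀ i : Fin n, MemLp (fun ω : Fin n → Z => f (ω i)) 2 Q := fun i =>
    hfL.comp_measurePreserving (hmp i)
  have hmean : ∫ t, hits A t ∂Q = n * P.real A := by
    have h1 : ∀ t : Fin n → Z, hits A t = ∑ i, f (t i) := fun t => rfl
    simp_rw [h1]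
    rw [integral_finsetSum _ fun i _ => (hL i).integrable one_le_two]
    have h2 : ∀ i : Fin n, ∫ ω, f (ω i) ∂Q = P.real A := by
      intro i
      rw [← hint, ← (hmp i).map_eq, integral_map (hmp i).measurable.aemeasurable
        hf.aestronglyMeasurable]
    simp [h2]
  have hV : Var[(hits A : (Fin n → Z) → ℝ); Q] ≤ n * P.real A := by
    rw [hsum, variance_sum_pi fun _ => hfL]
    simpa using mul_le_mul_of_nonneg_left hvar (Nat.cast_nonneg n)
  have hHL : MemLp (hits A : (Fin n → Z) → ℝ) 2 Q := by
    rw [hsum]; exact memLp_finsetSum' _ fun i _ => hL i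
  have hM : 0 ≤ (n : ℝ) * P.real A := by positivity
  have hc : 0 < √(2 * (n * P.real A + 1)) := by positivity
  have hch := meas_ge_le_variance_div_sq hHL hc
  rw [hmean, Real.sq_sqrt (by positivity)] at hch
  have hle : Q {t | √(2 * (n * P.real A + 1)) ≤ |hits A t - n * P.real A|} ≤ 1 / 2 := by
    refine hch.trans ?_
    rw [← ENNReal.ofReal_one, ← ENNReal.ofReal_ofNat 2, ← ENNReal.ofReal_div_of_pos two_pos]
    refine ENNReal.ofReal_le_ofReal ?_
    rw [div_le_div_iff₀ (by positivity) two_pos]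
    linarith
  have hms : MeasurableSet
      {t : Fin n → Z | √(2 * (n * P.real A + 1)) ≤ |hits A t - n * P.real A|} :=
    measurableSet_le measurable_const ((measurable_hits hA).sub_const _).abs
  have hcompl : {t : Fin n → Z | |hits A t - n * P.real A| < √(2 * (n * P.real A + 1))} =
      {t : Fin n → Z | √(2 * (n * P.real A + 1)) ≤ |hits A t - n * P.real A|}ᶜ := by
    ext t; simp
  rw [hcompl, prob_compl_eq_one_sub hms]
  calc (1 / 2 : ENNReal) = 1 - 1 / 2 := by
        rw [one_div, ENNReal.one_sub_inv_two]
    _ ≤ _ := tsub_le_tsub_left hle 1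

/-! ### Ghost sample and random swaps -/

/-- Symmetrization by a second independent sample. -/
theorem measure_iUnion_le_two_mul_prod {Ω ι : Type*} [MeasurableSpace Ω] [Countable ι]
    (Q : Measure Ω) [SFinite Q] (B D : ι → Set Ω) (hB : ∀ j, MeasurableSet (B j))
    (hD : ∀ j, MeasurableSet (D j)) (h : ∀ j, 1 / 2 ≤ Q (D j)) :
    Q (⋃ j, B j) ≤ 2 * (Q.prod Q) (⋃ j, B j ×ˢ D j) := by
  have hU : MeasurableSet (⋃ j, B j ×ˢ D j) := .iUnion fun j => (hB j).prod (hD j)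
  have h1 : (∫⁻ _ in ⋃ j, B j, (1 / 2) ∂Q) ≤ (Q.prod Q) (⋃ j, B j ×ˢ D j) := by
    rw [Measure.prod_apply hU]
    refine le_trans ?_ (setLIntegral_le_lintegral (⋃ j, B j) _)
    -- For x in some `B j`, the section of the product union at x contains `D j`, of measure at
    -- least 1/2.
    refine setLIntegral_mono' (.iUnion hB) fun x hx => ?_
    obtain ⟨j, hj⟩ := mem_iUnion.1 hx
    refine (h j).trans (measure_mono fun y hy => ?_)
    exact mem_iUnion.2 ⟨j, hj, hy⟩
  rw [setLIntegral_const] at h1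
  calc Q (⋃ j, B j) = 2 * (1 / 2 * Q (⋃ j, B j)) := by
        rw [← mul_assoc, one_div, ENNReal.mul_inv_cancel two_ne_zero ENNReal.ofNat_ne_top,
          one_mul]
    _ ≤ _ := by gcongr

/-- Exchange the two samples at the indices where `σ` is true. -/
def swapAt {Z : Type*} {n : ℕ} (σ : Fin n → Bool) (w : Fin n → Z × Z) : Fin n → Z × Z :=
  fun i => if σ i then (w i).swap else w i

theorem measurePreserving_swapAt {Z : Type*} [MeasurableSpace Z] (P : Measure Z)
    [IsProbabilityMeasure P] {n : ℕ} (σ : Fin n → Bool) :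
    MeasurePreserving (swapAt (Z := Z) σ) (Measure.pi fun _ => P.prod P)
      (Measure.pi fun _ => P.prod P) := by
  refine measurePreserving_pi (fun _ => P.prod P) (fun _ => P.prod P)
    (f := fun i z => if σ i then z.swap else z) fun i => ?_
  by_cases h : σ i
  · simpa [h] using Measure.measurePreserving_swap (μ := P) (ν := P)
  · simpa [h, Function.id_def] using MeasurePreserving.id (P.prod P)

open Classical in
-- Each of the 2ⁿ swaps preserves the measure, so averaging over them reduces a probability to
-- counting swaps of a fixed double sample.
theorem measure_pi_prod_le {Z : Type*} [MeasurableSpace Z] (P : Measure Z)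
    [IsProbabilityMeasure P] {n : ℕ} {U : Set (Fin n → Z × Z)} (hU : MeasurableSet U) {c : ℝ}
    (h : ∀ w, ((Finset.univ.filter fun σ => swapAt σ w ∈ U).card : ℝ) ≤ 2 ^ n * c) :
    Measure.pi (fun _ => P.prod P) U ≤ ENNReal.ofReal c := by
  set Q := Measure.pi (fun _ : Fin n => P.prod P)
  have hm : ∀ σ : Fin n → Bool, MeasurableSet (swapAt σ ⁻¹' U) := fun σ =>
    (measurePreserving_swapAt P σ).measurable hU
  have h1 : ∑ σ : Fin n → Bool, Q (swapAt σ ⁻¹' U) = 2 ^ n * Q U := by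
    have : ∀ σ : Fin n → Bool, Q (swapAt σ ⁻¹' U) = Q U := fun σ =>
      (measurePreserving_swapAt P σ).measure_preimage hU.nullMeasurableSet
    simp [this]
  have h2 : ∑ σ : Fin n → Bool, Q (swapAt σ ⁻¹' U) ≤ 2 ^ n * ENNReal.ofReal c := by
    calc ∑ σ : Fin n → Bool, Q (swapAt σ ⁻¹' U)
        = ∑ σ : Fin n → Bool, ∫⁻ w, (swapAt σ ⁻¹' U).indicator 1 w ∂Q := by
          simp_rw [lintegral_indicator_one (hm _)]
      _ = ∫⁻ w, ∑ σ : Fin n → Bool, (swapAt σ ⁻¹' U).indicator 1 w ∂Q := by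
          rw [lintegral_finsetSum]
          exact fun σ _ => measurable_one.indicator (hm σ)
      _ ≤ ∫⁻ _, 2 ^ n * ENNReal.ofReal c ∂Q := by
          refine lintegral_mono fun w => ?_
          have h3 : ∑ σ : Fin n → Bool, (swapAt σ ⁻¹' U).indicator (1 : (Fin n → Z × Z) → ENNReal) w =
              ((Finset.univ.filter fun σ => swapAt σ w ∈ U).card : ENNReal) := by
            simp only [indicator_apply, mem_preimage, Pi.one_apply, Finset.sum_boole]
          rw [h3, ← ENNReal.ofReal_natCast]
          refine (ENNReal.ofReal_le_ofReal (h w)).trans_eq ?_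
          rw [ENNReal.ofReal_mul (by positivity), ENNReal.ofReal_pow zero_le_two,
            ENNReal.ofReal_ofNat]
      _ = _ := by simp
  rw [h1] at h2
  exact (ENNReal.mul_le_mul_iff_right (by simp) (by simp)).1 h2

/-- A relative deviation of one sample forces a relative deviation between it and a second,
typical, sample. -/
theorem sqrt_lt_abs_sub_of_deviation {k₁ k₂ M L : ℝ} (hk₁ : 0 ≤ k₁) (hk₂ : 0 ≤ k₂) (hM : 0 ≤ M)
    (hL : 1 ≤ L) (hbad : 8 * √(k₁ * L) < k₁ - M ∨ 8 * √(M * L) < M - k₁)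
    (hgood : |k₂ - M| < √(2 * (M + 1))) :
    √(18 * (k₁ + k₂) * L) < |k₁ - k₂| := by
  have hg := abs_lt.1 hgood
  rcases hbad with hb | hb
  · set s := √(k₁ * L) with hs
    have hs0 : 0 ≤ s := Real.sqrt_nonneg _
    have hs2 : s ^ 2 = k₁ * L := Real.sq_sqrt (by positivity)
    have hMk : M < k₁ := by linarith
    have hk64 : 64 ≤ k₁ := by
      by_contra! h
      nlinarith
    -- The ghost sample consumes at most 2s of the deviation 8s; the remaining 6s suffices because
    -- k₂ ≤ k₁ gives 18 (k₁ + k₂) L ≤ 36 s².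
    have h1 : √(2 * (M + 1)) ≤ 2 * s := by
      rw [Real.sqrt_le_left (by positivity)]
      nlinarith
    have h2 : 6 * s < k₁ - k₂ := by linarith [hg.2]
    have h3 : 6 * s < |k₁ - k₂| := h2.trans_le (le_abs_self _)
    refine lt_of_le_of_lt ?_ h3
    rw [Real.sqrt_le_left (by positivity)]
    nlinarith
  · set s := √(M * L) with hs
    have hs0 : 0 ≤ s := Real.sqrt_nonneg _
    have hs2 : s ^ 2 = M * L := Real.sq_sqrt (by positivity)
    have hMs : 8 * s < M := by linarith
    have hM64 : 64 * L ≤ M := by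
      by_contra! h
      nlinarith
    have h1 : √(2 * (M + 1)) ≤ 2 * s := by
      rw [Real.sqrt_le_left (by positivity)]
      nlinarith
    have h2 : 6 * s < k₂ - k₁ := by linarith [hg.1]
    have h3 : k₂ - k₁ ≤ |k₁ - k₂| := by rw [abs_sub_comm]; exact le_abs_self _
    have hsL : 8 * L ≤ s := by
      by_contra! h
      nlinarith
    rw [Real.sqrt_lt' (by linarith)]
    refine lt_of_lt_of_le ?_ (pow_le_pow_left₀ (by linarith) h3 2)
    -- If k₂ ≤ M, then k₁ + k₂ ≤ 2M and 6s again suffices. An excess v = k₂ - M adds 18 v L to the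
    -- left side, paid for by the cross term 16 s v of (8s + v)², since s ≥ 8L.
    rcases le_total k₂ M with h | h
    · nlinarith
    · obtain ⟨v, rfl⟩ : ∃ v, k₂ = M + v := ⟨k₂ - M, by ring⟩
      have hv : 0 ≤ v := by linarith
      have h4 : 8 * s + v < M + v - k₁ := by linarith
      have h5 : (8 * s + v) ^ 2 < (M + v - k₁) ^ 2 := by
        apply pow_lt_pow_left₀ h4 (by positivity) two_ne_zero
      have h6 : v * (8 * L) ≤ v * s := mul_le_mul_of_nonneg_left hsL hv
      have h7 : k₁ * L ≤ M * L := by gcongr; linarith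
      nlinarith

theorem hits_add_hits_swapAt {Z : Type*} {n : ℕ} (A : Set Z) (w : Fin n → Z × Z)
    (σ : Fin n → Bool) :
    hits A (fun i => (swapAt σ w i).1) + hits A (fun i => (swapAt σ w i).2) =
      hits A (fun i => (w i).1) + hits A (fun i => (w i).2) := by
  simp only [hits, ← Finset.sum_add_distrib]
  refine Finset.sum_congr rfl fun i _ => ?_
  by_cases h : σ i
  · simp [swapAt, h, add_comm]
  · simp [swapAt, h]

/-- While the pooled count is invariant under swaps, the difference becomes a Rademacher sum. -/
theorem hits_sub_hits_swapAt {Z : Type*} {n : ℕ} (A : Set Z) (w : Fin n → Z × Z)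
    (σ : Fin n → Bool) :
    hits A (fun i => (swapAt σ w i).1) - hits A (fun i => (swapAt σ w i).2) =
      ∑ i, boolSign (σ i) * (A.indicator 1 (w i).1 - A.indicator 1 (w i).2) := by
  simp only [hits, ← Finset.sum_sub_distrib]
  refine Finset.sum_congr rfl fun i _ => ?_
  by_cases h : σ i
  · simp [swapAt, boolSign, h]
  · simp [swapAt, boolSign, h]

open Classical in
theorem card_swapAt_deviation_le_of_single {Z : Type*} {n : ℕ} (A : Set Z) (w : Fin n → Z × Z)
    {L : ℝ} (hL : 0 < L) :
    ((Finset.univ.filter fun σ : Fin n → Bool =>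
      √(18 * (hits A (fun i => (w i).1) + hits A (fun i => (w i).2)) * L) <
        |∑ i, boolSign (σ i) * (A.indicator 1 (w i).1 - A.indicator 1 (w i).2)|).card : ℝ) ≤
      2 ^ n * (2 * Real.exp (-(9 * L))) := by
  set N := hits A (fun i => (w i).1) + hits A (fun i => (w i).2) with hN
  have hsq : ∑ i, (A.indicator (1 : Z → ℝ) (w i).1 - A.indicator 1 (w i).2) ^ 2 ≤ N := by
    rw [hN]
    simp only [hits, ← Finset.sum_add_distrib]
    refine Finset.sum_le_sum fun i _ => ?_
    by_cases h₁ : (w i).1 ∈ A <;> by_cases h₂ : (w i).2 ∈ A <;> simp [h₁, h₂]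
  have hN0 : 0 ≤ N := add_nonneg (hits_nonneg _ _) (hits_nonneg _ _)
  -- The tail bound needs positive variance; for N = 0 all coefficients vanish and no swap
  -- qualifies.
  rcases hN0.eq_or_lt with h0 | hpos
  · have hz : ∀ i, A.indicator (1 : Z → ℝ) (w i).1 - A.indicator 1 (w i).2 = 0 := by
      intro i
      have h1 : ∑ i, (A.indicator (1 : Z → ℝ) (w i).1 - A.indicator 1 (w i).2) ^ 2 = 0 :=
        le_antisymm (hsq.trans h0.ge) (Finset.sum_nonneg fun _ _ => sq_nonneg _)
      rw [Finset.sum_eq_zero_iff_of_nonneg fun _ _ => sq_nonneg _] at h1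
      exact pow_eq_zero_iff two_ne_zero |>.1 (h1 i (Finset.mem_univ i))
    simp only [hz, ← h0, mul_zero, zero_mul, Real.sqrt_zero, Finset.sum_const_zero, abs_zero,
      lt_self_iff_false, Finset.filter_false, Finset.card_empty, Nat.cast_zero]
    positivity
  · have h := card_lt_abs_signed_le _ hpos hsq (τ := √(18 * N * L)) (by positivity)
    rw [Real.sq_sqrt (by positivity)] at h
    have h9 : 18 * N * L / (2 * N) = 9 * L := by field_simp; norm_num
    rwa [h9] at h

/-- Points of a double sample, indexed by the place in the sample and the copy. -/
def doubleSample {Z : Type*} {n : ℕ} (w : Fin n → Z × Z) (p : Fin n × Bool) : Z :=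
  if p.2 then (w p.1).2 else (w p.1).1

open Classical in
-- The event for `A j` depends only on the trace of `A j` on the 2n points, so the union bound runs
-- over traces.
theorem card_swapAt_deviation_le {Z ι : Type*} {n : ℕ} (A : ι → Set Z) (w : Fin n → Z × Z) {G : ℕ}
    (hG : (range fun j => doubleSample w ⁻¹' A j).ncard ≤ G) {L : ℝ} (hL : 0 < L) :
    ((Finset.univ.filter fun σ : Fin n → Bool => ∃ j,
      √(18 * (hits (A j) (fun i => (swapAt σ w i).1) +
        hits (A j) (fun i => (swapAt σ w i).2)) * L) <
        |hits (A j) (fun i => (swapAt σ w i).1) -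
          hits (A j) (fun i => (swapAt σ w i).2)|).card : ℝ) ≤
      2 ^ n * (G * (2 * Real.exp (-(9 * L)))) := by
  set T : Set (Set (Fin n × Bool)) := range fun j => doubleSample w ⁻¹' A j
  have hT : T.Finite := Set.toFinite _
  have hrep : ∀ S ∈ T, ∃ j, doubleSample w ⁻¹' A j = S := fun S hS => hS
  rcases isEmpty_or_nonempty ι with hι | hι
  · simp only [IsEmpty.exists_iff, Finset.filter_false, Finset.card_empty, Nat.cast_zero]
    positivity
  choose! r hr using hrep
  set ev : ι → Finset (Fin n → Bool) := fun j => Finset.univ.filter fun σ =>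
    √(18 * (hits (A j) (fun i => (w i).1) + hits (A j) (fun i => (w i).2)) * L) <
        |∑ i, boolSign (σ i) * ((A j).indicator 1 (w i).1 - (A j).indicator 1 (w i).2)| with hev
  have hdep : ∀ j j', doubleSample w ⁻¹' A j = doubleSample w ⁻¹' A j' → ev j = ev j' := by
    intro j j' h
    have h1 : ∀ i, (w i).1 ∈ A j ↔ (w i).1 ∈ A j' := fun i => by
      simpa [doubleSample] using Set.ext_iff.1 h (i, false)
    have h2 : ∀ i, (w i).2 ∈ A j ↔ (w i).2 ∈ A j' := fun i => by
      simpa [doubleSample] using Set.ext_iff.1 h (i, true)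
    simp only [hev, hits, indicator_apply, h1, h2]
  have hsub : (Finset.univ.filter fun σ : Fin n → Bool => ∃ j,
      √(18 * (hits (A j) (fun i => (swapAt σ w i).1) +
        hits (A j) (fun i => (swapAt σ w i).2)) * L) <
        |hits (A j) (fun i => (swapAt σ w i).1) -
          hits (A j) (fun i => (swapAt σ w i).2)|) ⊆
      hT.toFinset.biUnion fun S => ev (r S) := by
    intro σ hσ
    obtain ⟨j, hj⟩ := (Finset.mem_filter.1 hσ).2
    rw [hits_add_hits_swapAt, hits_sub_hits_swapAt] at hj
    refine Finset.mem_biUnion.2 ⟨doubleSample w ⁻¹' A j, hT.mem_toFinset.2 ⟨j, rfl⟩, ?_⟩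
    rw [hdep _ j (hr _ ⟨j, rfl⟩)]
    exact Finset.mem_filter.2 ⟨Finset.mem_univ _, hj⟩
  calc _ ≤ ((hT.toFinset.biUnion fun S => ev (r S)).card : ℝ) :=
        Nat.cast_le.2 (Finset.card_le_card hsub)
    _ ≤ ((∑ S ∈ hT.toFinset, (ev (r S)).card : ℕ) : ℝ) := Nat.cast_le.2 Finset.card_biUnion_le
    _ = ∑ S ∈ hT.toFinset, ((ev (r S)).card : ℝ) := by push_cast; rfl
    _ ≤ ∑ S ∈ hT.toFinset, 2 ^ n * (2 * Real.exp (-(9 * L))) :=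
        Finset.sum_le_sum fun S _ => card_swapAt_deviation_le_of_single _ _ hL
    _ = T.ncard * (2 ^ n * (2 * Real.exp (-(9 * L)))) := by
        rw [Finset.sum_const, nsmul_eq_mul, Set.ncard_eq_toFinset_card T hT]
    _ ≤ G * (2 ^ n * (2 * Real.exp (-(9 * L)))) := by gcongr
    _ = _ := by ring

/-- The count of `A` in the sample `t` is close, in the relative sense, to its expectation. -/
def IsTypical {Z : Type*} [MeasurableSpace Z] (P : Measure Z) (L : ℝ) {n : ℕ} (A : Set Z)
    (t : Fin n → Z) : Prop :=
  hits A t - n * P.real A ≤ 8 * √(hits A t * L) ∧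
    n * P.real A - hits A t ≤ 8 * √(n * P.real A * L)

theorem measurableSet_isTypical {Z : Type*} [MeasurableSpace Z] (P : Measure Z) (L : ℝ) {n : ℕ}
    {A : Set Z} (hA : MeasurableSet A) :
    MeasurableSet {t : Fin n → Z | IsTypical P L A t} := by
  have h := measurable_hits (n := n) hA
  exact (measurableSet_le (f := fun t : Fin n → Z => hits A t - n * P.real A)
      (g := fun t => 8 * √(hits A t * L)) (by fun_prop) (by fun_prop)).inter
    (measurableSet_le (f := fun t : Fin n → Z => n * P.real A - hits A t)
      (g := fun _ => 8 * √(n * P.real A * L)) (by fun_prop) (by fun_prop))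

/-- The factor 4 is 2 from the ghost sample times 2 from the two-sided tail. Countability of the
index set gives measurability. -/
theorem measure_exists_not_isTypical_le {Z ι : Type*} [MeasurableSpace Z] [Countable ι]
    (P : Measure Z) [IsProbabilityMeasure P] {n G : ℕ} (A : ι → Set Z)
    (hA : ∀ j, MeasurableSet (A j))
    (hG : ∀ q : Fin n × Bool → Z, (range fun j => q ⁻¹' A j).ncard ≤ G) {L : ℝ} (hL : 1 ≤ L) :
    Measure.pi (fun _ : Fin n => P) {t | ∃ j, ¬ IsTypical P L (A j) t} ≤
      ENNReal.ofReal (4 * G * Real.exp (-(9 * L))) := by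
  classical
  set Q := Measure.pi (fun _ : Fin n => P)
  set B : ι → Set (Fin n → Z) := fun j => {t | IsTypical P L (A j) t}ᶜ
  set D : ι → Set (Fin n → Z) := fun j =>
    {t | |hits (A j) t - n * P.real (A j)| < √(2 * (n * P.real (A j) + 1))}
  have hB : ∀ j, MeasurableSet (B j) := fun j => (measurableSet_isTypical P L (hA j)).compl
  have hD : ∀ j, MeasurableSet (D j) := fun j =>
    measurableSet_lt ((measurable_hits (hA j)).sub_const _).abs measurable_const
  have hset : {t : Fin n → Z | ∃ j, ¬ IsTypical P L (A j) t} = ⋃ j, B j := by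
    ext t; simp [B]
  rw [hset]
  refine (measure_iUnion_le_two_mul_prod Q B D hB hD
    fun j => half_le_measure_abs_hits_sub_lt P (hA j)).trans ?_
  have hmp := measurePreserving_arrowProdEquivProdArrow Z Z (Fin n) (fun _ => P) (fun _ => P)
  have hU : MeasurableSet (⋃ j, B j ×ˢ D j) := .iUnion fun j => (hB j).prod (hD j)
  rw [← hmp.measure_preimage hU.nullMeasurableSet]
  have h4 : ENNReal.ofReal (4 * G * Real.exp (-(9 * L))) =
      2 * ENNReal.ofReal (G * (2 * Real.exp (-(9 * L)))) := by
    rw [← ENNReal.ofReal_ofNat 2, ← ENNReal.ofReal_mul zero_le_two]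
    congr 1; ring
  rw [h4]
  gcongr
  refine measure_pi_prod_le P (hmp.measurable hU) fun w => ?_
  refine le_trans (Nat.cast_le.2 (Finset.card_le_card ?_))
    (card_swapAt_deviation_le A w (hG _) (zero_lt_one.trans_le hL))
  intro σ hσ
  have hσ := (Finset.mem_filter.1 hσ).2
  obtain ⟨j, hj⟩ := mem_iUnion.1 hσ
  refine Finset.mem_filter.2 ⟨Finset.mem_univ _, j, ?_⟩
  have hj1 : ¬ IsTypical P L (A j) (fun i => (swapAt σ w i).1) := hj.1
  have hj2 : |hits (A j) (fun i => (swapAt σ w i).2) - n * P.real (A j)| <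
    √(2 * (n * P.real (A j) + 1)) := hj.2
  rw [IsTypical, not_and_or, not_le, not_le] at hj1
  exact sqrt_lt_abs_sub_of_deviation (hits_nonneg _ _) (hits_nonneg _ _) (by positivity) hL hj1 hj2

/-! ### The counts of all closed balls are typical -/

theorem hits_mono {Z : Type*} {n : ℕ} {A B : Set Z} (h : A ⊆ B) (t : Fin n → Z) :
    hits A t ≤ hits B t :=
  Finset.sum_le_sum fun _ _ => Set.indicator_le_indicator_of_subset h (fun _ => zero_le_one) _

theorem tendsto_hits_of_antitone {Z : Type*} {n : ℕ} {A : ℕ → Set Z} (hA : Antitone A)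
    (t : Fin n → Z) : Tendsto (fun m => hits (A m) t) atTop (𝓝 (hits (⋂ m, A m) t)) :=
  tendsto_finsetSum _ fun _ _ => (hA.tendsto_indicator _ _ _).mono_right (pure_le_nhds _)

/-- Typicality passes to the intersection of a decreasing sequence of sets that is interlaced with
typical sets. -/
theorem IsTypical.iInter {Z : Type*} [MeasurableSpace Z] {P : Measure Z} [IsProbabilityMeasure P]
    {L : ℝ} {n : ℕ} {t : Fin n → Z} {C A : ℕ → Set Z} (hC : Antitone C)
    (hCm : ∀ m, MeasurableSet (C m)) (hA : ∀ m, IsTypical P L (A m) t)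
    (hsub : ∀ m, ⋂ m, C m ⊆ A m) (hsup : ∀ m, A m ⊆ C m) : IsTypical P L (⋂ m, C m) t := by
  have h1 : Tendsto (fun m => hits (A m) t) atTop (𝓝 (hits (⋂ m, C m) t)) :=
    tendsto_of_tendsto_of_tendsto_of_le_of_le tendsto_const_nhds (tendsto_hits_of_antitone hC t)
      (fun m => hits_mono (hsub m) t) (fun m => hits_mono (hsup m) t)
  have h2 : Tendsto (fun m => P.real (C m)) atTop (𝓝 (P.real (⋂ m, C m))) :=
    (ENNReal.tendsto_toReal (measure_ne_top _ _)).comp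
      (tendsto_measure_iInter_atTop (fun m => (hCm m).nullMeasurableSet) hC
        ⟨0, measure_ne_top _ _⟩)
  have h3 : Tendsto (fun m => P.real (A m)) atTop (𝓝 (P.real (⋂ m, C m))) :=
    tendsto_of_tendsto_of_tendsto_of_le_of_le tendsto_const_nhds h2
      (fun m => measureReal_mono (hsub m)) (fun m => measureReal_mono (hsup m))
  have h4 := h3.const_mul (n : ℝ)
  exact ⟨le_of_tendsto_of_tendsto' (h1.sub h4) ((h1.mul_const L).sqrt.const_mul 8)
      fun m => (hA m).1,
    le_of_tendsto_of_tendsto' (h4.sub h1) ((h4.mul_const L).sqrt.const_mul 8)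
      fun m => (hA m).2⟩

/-- A countable family of closed balls: the centres run through a dense sequence, and the radii are
rational. -/
def ratBall (X : Type*) [MetricSpace X] [TopologicalSpace.SeparableSpace X] [Nonempty X]
    (j : ℕ × ℚ≥0) : Set X :=
  Metric.closedBall (TopologicalSpace.denseSeq X j.1) (j.2 : ℝ)

theorem exists_ratBall_between {X : Type*} [MetricSpace X] [TopologicalSpace.SeparableSpace X]
    [Nonempty X] (x : X) {r ε : ℝ} (hr : 0 ≤ r) (hε : 0 < ε) :
    ∃ j, Metric.closedBall x r ⊆ ratBall X j ∧ ratBall X j ⊆ Metric.closedBall x (r + ε) := by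
  obtain ⟨i, hi⟩ := (TopologicalSpace.denseRange_denseSeq X).exists_dist_lt x
    (show 0 < ε / 3 by linarith)
  obtain ⟨q, hq1, hq2⟩ := exists_rat_btwn (show r + ε / 3 < r + 2 * ε / 3 by linarith)
  have hq0 : 0 ≤ q := by
    have : (0 : ℝ) ≤ q := by linarith
    exact_mod_cast this
  refine ⟨(i, ⟨q, hq0⟩), ?_, ?_⟩
  · refine Metric.closedBall_subset_closedBall' ?_
    change r + dist x _ ≤ ((q : ℚ) : ℝ)
    linarith
  · refine Metric.closedBall_subset_closedBall' ?_
    change ((q : ℚ) : ℝ) + dist _ x ≤ r + ε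
    rw [dist_comm]
    linarith

theorem iInter_closedBall_add {X : Type*} [MetricSpace X] (x : X) (r : ℝ) :
    ⋂ m : ℕ, Metric.closedBall x (r + 1 / ((m : ℝ) + 1)) = Metric.closedBall x r := by
  ext z
  simp only [mem_iInter, Metric.mem_closedBall]
  refine ⟨fun h => ?_, fun h m => h.trans (by linarith [Nat.one_div_pos_of_nat (α := ℝ) (n := m)])⟩
  have h1 := (tendsto_one_div_add_atTop_nhds_zero_nat (𝕜 := ℝ)).const_add r
  rw [add_zero] at h1
  exact ge_of_tendsto' h1 h

theorem antitone_closedBall_add {X : Type*} [MetricSpace X] (x : X) (r : ℝ) :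
    Antitone fun m : ℕ => Metric.closedBall x (r + 1 / ((m : ℝ) + 1)) := fun m m' h =>
  Metric.closedBall_subset_closedBall (by
    have : (m : ℝ) ≤ m' := Nat.cast_le.2 h
    gcongr)

theorem measurableSet_singleton_intUnits (s : ℤˣ) : MeasurableSet ({s} : Set ℤˣ) :=
  ⟨{(s : ℤ)}, measurableSet_singleton _, by ext; simp [Units.ext_iff]⟩

/-- The VC bound is applied to countably many rational balls, once per label, and reaches all balls
by approximation from outside. -/
theorem exists_event_isTypical {X : Type*} [MetricSpace X] [TopologicalSpace.SeparableSpace X]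
    [MeasurableSpace X] [BorelSpace X] {d : ℕ} (hd : vcDim (ballFamily X) ≤ d)
    (P : Measure (X × ℤˣ)) [IsProbabilityMeasure P] (n : ℕ) {L : ℝ} (hL : 1 ≤ L) :
    ∃ E : Set (Fin n → X × ℤˣ), MeasurableSet E ∧
      ENNReal.ofReal (1 - 8 * (2 * n + 1) ^ d * Real.exp (-(9 * L))) ≤
        Measure.pi (fun _ => P) E ∧
      ∀ t ∈ E, ∀ (x : X) (r : ℝ), 0 ≤ r → ∀ s : ℤˣ,
        IsTypical P L (Metric.closedBall x r ×ˢ {s}) t := by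
  have : Nonempty (X × ℤˣ) := nonempty_of_isProbabilityMeasure P
  have : Nonempty X := ‹Nonempty (X × ℤˣ)›.map Prod.fst
  set A : ℤˣ → ℕ × ℚ≥0 → Set (X × ℤˣ) := fun s j => ratBall X j ×ˢ {s}
  have hs : ∀ s : ℤˣ, MeasurableSet ({s} : Set ℤˣ) := measurableSet_singleton_intUnits
  have hA : ∀ s j, MeasurableSet (A s j) := fun s j =>
    Metric.isClosed_closedBall.measurableSet.prod (hs s)
  have hG : ∀ s, ∀ q : Fin n × Bool → X × ℤˣ,
      (range fun j => q ⁻¹' A s j).ncard ≤ (2 * n + 1) ^ d := by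
    intro s q
    have h1 := ncard_traces_le hd (fun p => (q p).1)
    rw [Fintype.card_prod, Fintype.card_fin, Fintype.card_bool, mul_comm n 2] at h1
    -- Fixing the label cuts every ball trace with the same index set, so no new traces appear.
    refine le_trans ?_ ((Set.ncard_image_le (f := fun T : Set (Fin n × Bool) =>
      T ∩ {p | (q p).2 = s}) (Set.toFinite _)).trans h1)
    refine Set.ncard_le_ncard ?_ (Set.toFinite _)
    rintro _ ⟨j, rfl⟩
    refine ⟨_, ⟨ratBall X j, ⟨_, _, ?_, rfl⟩, rfl⟩, ?_⟩
    · exact_mod_cast j.2.2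
    · ext p; simp [A]
  set Q := Measure.pi (fun _ : Fin n => P)
  set bad : ℤˣ → Set (Fin n → X × ℤˣ) := fun s => {t | ∃ j, ¬ IsTypical P L (A s j) t}
  have hbm : ∀ s, MeasurableSet (bad s) := by
    intro s
    have : bad s = ⋃ j, {t | IsTypical P L (A s j) t}ᶜ := by ext t; simp [bad]
    rw [this]
    exact .iUnion fun j => (measurableSet_isTypical P L (hA s j)).compl
  have hbQ : ∀ s, Q (bad s) ≤ ENNReal.ofReal (4 * (2 * n + 1) ^ d * Real.exp (-(9 * L))) := by
    intro s
    have h := measure_exists_not_isTypical_le P (A s) (hA s) (hG s) hL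
    push_cast at h
    exact h
  refine ⟨(bad 1 ∪ bad (-1))ᶜ, ((hbm 1).union (hbm _)).compl, ?_, ?_⟩
  · rw [prob_compl_eq_one_sub ((hbm 1).union (hbm _)), ENNReal.ofReal_sub _ (by positivity),
      ENNReal.ofReal_one]
    refine tsub_le_tsub_left ?_ 1
    refine (measure_union_le _ _).trans ((add_le_add (hbQ _) (hbQ _)).trans_eq ?_)
    rw [← ENNReal.ofReal_add (by positivity) (by positivity)]
    congr 1; ring
  · intro t ht x r hr s
    have hts : ∀ j, IsTypical P L (A s j) t := by
      intro j
      by_contra h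
      refine ht ?_
      rcases Int.units_eq_one_or s with rfl | rfl
      · exact Or.inl ⟨j, h⟩
      · exact Or.inr ⟨j, h⟩
    choose j hj1 hj2 using fun m : ℕ =>
      exists_ratBall_between x hr (Nat.one_div_pos_of_nat (α := ℝ) (n := m))
    have hI : ⋂ m : ℕ, Metric.closedBall x (r + 1 / ((m : ℝ) + 1)) ×ˢ ({s} : Set ℤˣ) =
        Metric.closedBall x r ×ˢ {s} := by
      rw [← iInter_closedBall_add x r]
      ext z
      simp [forall_and]
    rw [← hI]
    refine IsTypical.iInter (A := fun m => A s (j m))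
      (fun m m' h => prod_mono_left (antitone_closedBall_add x r h))
      (fun m => Metric.isClosed_closedBall.measurableSet.prod (hs s)) (fun m => hts _) (fun m => ?_)
      fun m => prod_mono_left (hj2 m)
    rw [hI]
    exact prod_mono_left (hj1 m)

/-! ### Consequences of typicality for the label sums -/

/-- A label that is not favoured in expectation cannot win significantly. Writing all quantities as
squares makes the typicality conditions quadratic inequalities. -/
theorem sub_le_of_typical {k₁ k₂ M₁ M₂ L c : ℝ} (hk₁ : 0 ≤ k₁) (hk₂ : 0 ≤ k₂) (hM₁ : 0 ≤ M₁)
    (hL : 0 < L) (h₁ : M₁ - k₁ ≤ 8 * √(M₁ * L)) (h₂ : k₂ - M₂ ≤ 8 * √(k₂ * L))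
    (hM : M₂ ≤ M₁) (hc : 32 ≤ c) : k₂ - k₁ ≤ c * √((k₁ + k₂) * L) := by
  obtain ⟨l, hl, rfl⟩ : ∃ l, 0 < l ∧ L = l ^ 2 := ⟨√L, by positivity, (Real.sq_sqrt hL.le).symm⟩
  obtain ⟨a, ha, rfl⟩ : ∃ a, 0 ≤ a ∧ k₁ = a ^ 2 :=
    ⟨√k₁, by positivity, (Real.sq_sqrt hk₁).symm⟩
  obtain ⟨b, hb, rfl⟩ : ∃ b, 0 ≤ b ∧ k₂ = b ^ 2 :=
    ⟨√k₂, by positivity, (Real.sq_sqrt hk₂).symm⟩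
  obtain ⟨u, hu, rfl⟩ : ∃ u, 0 ≤ u ∧ M₁ = u ^ 2 :=
    ⟨√M₁, by positivity, (Real.sq_sqrt hM₁).symm⟩
  rw [← mul_pow, Real.sqrt_sq (by positivity)] at h₁ h₂
  rw [Real.sqrt_mul' _ (by positivity), Real.sqrt_sq hl.le]
  set w := √(a ^ 2 + b ^ 2) with hw
  have hw0 : 0 ≤ w := Real.sqrt_nonneg _
  have hw2 : w ^ 2 = a ^ 2 + b ^ 2 := Real.sq_sqrt (by positivity)
  have haw : a ≤ w := by
    rw [hw]; exact Real.le_sqrt_of_sq_le (by nlinarith)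
  have hbw : b ≤ w := by
    rw [hw]; exact Real.le_sqrt_of_sq_le (by nlinarith)
  have hua : u ≤ a + 8 * l := by
    by_contra! h
    nlinarith
  have hmain : b ^ 2 - a ^ 2 ≤ 16 * (w * l) + 64 * l ^ 2 := by
    have h3 : b * l ≤ w * l := by gcongr
    have h4 : a * l ≤ w * l := by gcongr
    have h5 : u * l ≤ (a + 8 * l) * l := by gcongr
    nlinarith
  -- For small w the trivial bound b² ≤ w² already gives 32 w l; otherwise 64 l² ≤ 2 w l.
  rcases le_total w (32 * l) with h | h
  · have h6 : w * w ≤ w * (32 * l) := by gcongr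
    have h7 : 32 * (w * l) ≤ c * (w * l) := by gcongr
    nlinarith [sq_nonneg a]
  · have h6 : 32 * l * l ≤ w * l := by gcongr
    have h7 : 32 * (w * l) ≤ c * (w * l) := by gcongr
    nlinarith

/-- With w² = M₁ + M₂ and l² = L, the signal γ w² loses at most 17 w l to noise and the threshold is
at most 2 c w l. The constant 81 covers the 17 and, as γ ≤ 1, forces w ≥ 81 l, which absorbs the l²
terms. -/
theorem lt_sub_of_typical {k₁ k₂ M₁ M₂ L c γ : ℝ} (hk₁ : 0 ≤ k₁) (hk₂ : 0 ≤ k₂) (hM₁ : 0 ≤ M₁)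
    (hM₂ : 0 ≤ M₂) (hL : 0 < L) (h₁ : k₁ - M₁ ≤ 8 * √(k₁ * L) ∧ M₁ - k₁ ≤ 8 * √(M₁ * L))
    (h₂ : k₂ - M₂ ≤ 8 * √(k₂ * L)) (hγ : 0 < γ) (hM : γ * (M₁ + M₂) ≤ M₁ - M₂) (hc : 0 ≤ c)
    (hlarge : (81 + 2 * c) ^ 2 * L < γ ^ 2 * (M₁ + M₂)) :
    c * √((k₁ + k₂) * L) < k₁ - k₂ := by
  obtain ⟨l, hl, rfl⟩ : ∃ l, 0 < l ∧ L = l ^ 2 := ⟨√L, by positivity, (Real.sq_sqrt hL.le).symm⟩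
  obtain ⟨a, ha, rfl⟩ : ∃ a, 0 ≤ a ∧ k₁ = a ^ 2 :=
    ⟨√k₁, by positivity, (Real.sq_sqrt hk₁).symm⟩
  obtain ⟨b, hb, rfl⟩ : ∃ b, 0 ≤ b ∧ k₂ = b ^ 2 :=
    ⟨√k₂, by positivity, (Real.sq_sqrt hk₂).symm⟩
  obtain ⟨u, hu, rfl⟩ : ∃ u, 0 ≤ u ∧ M₁ = u ^ 2 :=
    ⟨√M₁, by positivity, (Real.sq_sqrt hM₁).symm⟩
  obtain ⟨v, hv, rfl⟩ : ∃ v, 0 ≤ v ∧ M₂ = v ^ 2 :=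
    ⟨√M₂, by positivity, (Real.sq_sqrt hM₂).symm⟩
  rw [← mul_pow, Real.sqrt_sq (by positivity)] at h₁ h₂
  rw [← mul_pow, Real.sqrt_sq (by positivity)] at h₁
  rw [Real.sqrt_mul' _ (by positivity), Real.sqrt_sq hl.le]
  set w := √(u ^ 2 + v ^ 2) with hw
  have hw0 : 0 ≤ w := Real.sqrt_nonneg _
  have hw2 : w ^ 2 = u ^ 2 + v ^ 2 := Real.sq_sqrt (by positivity)
  have huw : u ≤ w := by
    rw [hw]; exact Real.le_sqrt_of_sq_le (by nlinarith)
  have hvw : v ≤ w := by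
    rw [hw]; exact Real.le_sqrt_of_sq_le (by nlinarith)
  rw [← hw2] at hM hlarge
  have hγw : (81 + 2 * c) * l < γ * w :=
    lt_of_pow_lt_pow_left₀ 2 (by positivity) (by rw [mul_pow, mul_pow]; exact hlarge)
  have hwpos : 0 < w := by
    by_contra! h
    have : w = 0 := le_antisymm h hw0
    rw [this, mul_zero] at hγw
    have : 0 < (81 + 2 * c) * l := by positivity
    linarith
  have hγ1 : γ ≤ 1 := by
    by_contra! h
    have : 1 * w ^ 2 < γ * w ^ 2 := by gcongr
    nlinarith [sq_nonneg v]
  have hlw : 81 * l ≤ w := by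
    have h1 : γ * w ≤ 1 * w := by gcongr
    nlinarith [mul_nonneg hc hl.le]
  have hau : a ≤ u + 8 * l := by
    by_contra! h
    nlinarith [h₁.1]
  have hbv : b ≤ v + 8 * l := by
    by_contra! h
    nlinarith
  have hul : u * l ≤ w * l := by gcongr
  have hvl : v * l ≤ w * l := by gcongr
  have hll : 81 * l * l ≤ w * l := by gcongr
  have hww : w * (81 * l) ≤ w * w := by gcongr
  have hk : √(a ^ 2 + b ^ 2) ≤ 2 * w := by
    rw [Real.sqrt_le_left (by positivity)]
    have h1 : a ^ 2 ≤ (u + 8 * l) ^ 2 := by gcongr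
    have h2 : b ^ 2 ≤ (v + 8 * l) ^ 2 := by gcongr
    nlinarith
  have hS : γ * w ^ 2 - 17 * (w * l) ≤ a ^ 2 - b ^ 2 := by
    have h2 : b * l ≤ (v + 8 * l) * l := by gcongr
    nlinarith [h₁.2]
  have hfin : (81 + 2 * c) * l * w < γ * w * w := by gcongr
  have hcl : c * (√(a ^ 2 + b ^ 2) * l) ≤ c * (2 * w * l) := by gcongr
  nlinarith [mul_pos hwpos hl]

/-! ### Counts, label sums and biases of a set, in terms of its two labelled parts -/

/-- The sum of the labels of the training points in a set. -/
def labelSum {X : Type*} {n : ℕ} (t : Fin n → X × ℤˣ) (S : Set X) : ℝ :=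
  ∑ i ∈ indicesIn t S, (((t i).2 : ℤ) : ℝ)

theorem mem_indicesIn {X : Type*} {n : ℕ} {t : Fin n → X × ℤˣ} {S : Set X} {i : Fin n} :
    i ∈ indicesIn t S ↔ (t i).1 ∈ S := by
  classical simp [indicesIn]

theorem indicesIn_mono {X : Type*} {n : ℕ} (t : Fin n → X × ℤˣ) {S T : Set X} (h : S ⊆ T) :
    indicesIn t S ⊆ indicesIn t T := fun _ hi => mem_indicesIn.2 (h (mem_indicesIn.1 hi))

/-- The factor s lets one argument serve both signs; `IsBias.mul_setIntegral` is the population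
counterpart. -/
theorem mul_labelSum {X : Type*} {n : ℕ} (t : Fin n → X × ℤˣ) (S : Set X) (s : ℤˣ) :
    ((s : ℤ) : ℝ) * labelSum t S = hits (S ×ˢ {s}) t - hits (S ×ˢ {-s}) t := by
  classical
  rw [labelSum, indicesIn, Finset.sum_filter, Finset.mul_sum, hits, hits,
    ← Finset.sum_sub_distrib]
  refine Finset.sum_congr rfl fun i _ => ?_
  by_cases hi : (t i).1 ∈ S
  · rcases Int.units_eq_one_or s with rfl | rfl <;>
      rcases Int.units_eq_one_or (t i).2 with h | h <;>
      simp [mem_prod, hi, h]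
  · simp [mem_prod, hi]

theorem cast_empCount {X : Type*} {n : ℕ} (t : Fin n → X × ℤˣ) (S : Set X) (s : ℤˣ) :
    (empCount t S : ℝ) = hits (S ×ˢ {s}) t + hits (S ×ˢ {-s}) t := by
  classical
  rw [empCount, indicesIn, Finset.card_filter, hits, hits, ← Finset.sum_add_distrib]
  push_cast
  refine Finset.sum_congr rfl fun i _ => ?_
  by_cases hi : (t i).1 ∈ S
  · rcases Int.units_eq_one_or s with rfl | rfl <;>
      rcases Int.units_eq_one_or (t i).2 with h | h <;>
      simp [mem_prod, hi, h]
  · simp [mem_prod, hi]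

theorem fst_preimage_eq_union {X : Type*} (S : Set X) (s : ℤˣ) :
    (Prod.fst ⁻¹' S : Set (X × ℤˣ)) = S ×ˢ {s} ∪ S ×ˢ {-s} := by
  ext ⟨x, y⟩
  rcases Int.units_eq_one_or s with rfl | rfl <;>
    rcases Int.units_eq_one_or y with rfl | rfl <;> simp

theorem disjoint_prod_singleton_neg {X : Type*} (S : Set X) (s : ℤˣ) :
    Disjoint (S ×ˢ {s}) (S ×ˢ {-s}) := by
  refine Set.disjoint_left.2 ?_
  rintro ⟨x, y⟩ ⟨-, h₁⟩ ⟨-, h₂⟩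
  simp only [mem_singleton_iff] at h₁ h₂
  rcases Int.units_eq_one_or s with rfl | rfl <;> simp [h₁] at h₂

section Measure

variable {X : Type*} [MeasurableSpace X] {P : Measure (X × ℤˣ)} [IsProbabilityMeasure P]

theorem fst_real_eq_add {S : Set X} (hS : MeasurableSet S) (s : ℤˣ) :
    P.fst.real S = P.real (S ×ˢ {s}) + P.real (S ×ˢ {-s}) := by
  rw [measureReal_def, Measure.fst_apply hS, fst_preimage_eq_union S s, ← measureReal_def,
    measureReal_union (disjoint_prod_singleton_neg S s)
      (hS.prod (measurableSet_singleton_intUnits _))]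

theorem IsBias.mul_setIntegral {η : X → ℝ} (hη : IsBias P η) {S : Set X} (hS : MeasurableSet S)
    (s : ℤˣ) : ((s : ℤ) : ℝ) * ∫ x in S, η x ∂P.fst =
      P.real (S ×ˢ {s}) - P.real (S ×ˢ {-s}) := by
  have hm : ∀ u : ℤˣ, MeasurableSet (S ×ˢ ({u} : Set ℤˣ)) := fun u =>
    hS.prod (measurableSet_singleton_intUnits u)
  have heq : ∀ u : ℤˣ, EqOn (fun z : X × ℤˣ => ((z.2 : ℤ) : ℝ)) (fun _ => ((u : ℤ) : ℝ))
      (S ×ˢ {u}) := by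
    rintro u ⟨x, y⟩ ⟨-, h⟩
    simp only [mem_singleton_iff] at h
    simp [h]
  have hi : ∀ u : ℤˣ, IntegrableOn (fun z : X × ℤˣ => ((z.2 : ℤ) : ℝ)) (S ×ˢ {u}) P := fun u =>
    (integrableOn_congr_fun (heq u) (hm u)).2 integrableOn_const
  have hint : ∀ u : ℤˣ, ∫ z in S ×ˢ {u}, ((z.2 : ℤ) : ℝ) ∂P =
      P.real (S ×ˢ {u}) * ((u : ℤ) : ℝ) := by
    intro u
    rw [setIntegral_congr_fun (hm u) (heq u), setIntegral_const, smul_eq_mul]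
  rw [hη.setIntegral_eq S hS, fst_preimage_eq_union S s,
    setIntegral_union (disjoint_prod_singleton_neg S s) (hm _) (hi _) (hi _), hint, hint]
  rcases Int.units_eq_one_or s with rfl | rfl
  · simp; ring
  · simp; ring

end Measure

/-! ### The classifier on a given sample -/

theorem width_lt_abs_empBias_iff {X : Type*} {n : ℕ} (t : Fin n → X × ℤˣ) (c : ℝ)
    (d : ℕ) (δ : ℝ) {S : Set X} {k : ℕ} (hk : 0 < k) (hS : empCount t S = k) :
    width c d n k δ < |empBias t S| ↔
      c * √(k * (d * Real.log n + Real.log (1 / δ))) < |labelSum t S| := by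
  have hk' : (0 : ℝ) < k := Nat.cast_pos.2 hk
  set L := d * Real.log n + Real.log (1 / δ) with hL
  have h1 : √(k * L) = √(L / k) * k := by
    have : (k : ℝ) * L = L / k * k ^ 2 := by field_simp
    rw [this, Real.sqrt_mul' _ (by positivity), Real.sqrt_sq hk'.le]
  have h2 : empBias t S = labelSum t S / k := by rw [empBias, hS, labelSum]
  rw [h2, abs_div, abs_of_pos hk', lt_div_iff₀ hk', h1, width, ← hL, mul_assoc]

section Classifier

variable {X : Type*} [MetricSpace X] {n : ℕ} (t : Fin n → X × ℤˣ) (x : X)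

theorem empCount_closedBall_mono {r r' : ℝ} (h : r ≤ r') :
    empCount t (Metric.closedBall x r) ≤ empCount t (Metric.closedBall x r') :=
  Finset.card_le_card (indicesIn_mono t (Metric.closedBall_subset_closedBall h))

/-- The infimum is attained: balls being closed and the sample finite, slightly enlarging the radius
captures no new training point. -/
theorem sInf_kRadii_mem {k : ℕ} (h : (kRadii t x k).Nonempty) :
    sInf (kRadii t x k) ∈ kRadii t x k := by
  set r := sInf (kRadii t x k)
  have hbdd : BddBelow (kRadii t x k) := ⟨0, fun _ hr => hr.1⟩
  have hev : ∀ᶠ r' in 𝓝 r, ∀ i, dist (t i).1 x ≤ r' → dist (t i).1 x ≤ r := by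
    rw [eventually_all]
    intro i
    by_cases hi : dist (t i).1 x ≤ r
    · exact Eventually.of_forall fun _ _ => hi
    · push Not at hi
      filter_upwards [Iio_mem_nhds hi] with r' hr' h'
      exact absurd h' (not_le.2 hr')
  obtain ⟨r', hr', hk⟩ := mem_closure_iff_nhds.1 (csInf_mem_closure h hbdd) _ hev
  refine ⟨Real.sInf_nonneg fun _ hr => hr.1, le_antisymm ?_ ?_⟩
  · exact (empCount_closedBall_mono t x (csInf_le hbdd hk)).trans_eq hk.2
  · rw [← hk.2]
    exact Finset.card_le_card fun i hi => mem_indicesIn.2 (hr' i (mem_indicesIn.1 hi))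

theorem signLabel_eq {v : ℝ} {s : ℤˣ} (h : 0 < ((s : ℤ) : ℝ) * v) : signLabel v = s := by
  rcases Int.units_eq_one_or s with rfl | rfl
  · simp only [Units.val_one, Int.cast_one, one_mul] at h
    simp [signLabel, h]
  · simp only [Units.val_neg, Units.val_one, Int.cast_neg, Int.cast_one, neg_mul, one_mul,
      Left.neg_pos_iff] at h
    simp [signLabel, h.not_gt]

theorem abs_intUnits_mul (s : ℤˣ) (v : ℝ) : |((s : ℤ) : ℝ) * v| = |v| := by
  rcases Int.units_eq_one_or s with rfl | rfl <;> simp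

/-- If some ball about `x` is significantly biased towards `s`, and no smaller one is significantly
biased towards `-s`, then `x` is classified as `s`. -/
theorem classifier_eq_some {c : ℝ} (hc : 0 ≤ c) {d : ℕ} {δ : ℝ} {s : ℤˣ} {r₀ : ℝ} (hr₀ : 0 ≤ r₀)
    (hsig : c * √(empCount t (Metric.closedBall x r₀) * (d * Real.log n + Real.log (1 / δ))) <
      ((s : ℤ) : ℝ) * labelSum t (Metric.closedBall x r₀))
    (hsmall : ∀ r, 0 ≤ r → r < r₀ → -(((s : ℤ) : ℝ) * labelSum t (Metric.closedBall x r)) ≤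
      c * √(empCount t (Metric.closedBall x r) * (d * Real.log n + Real.log (1 / δ)))) :
    classifier c d δ t x = some s := by
  set k₀ := empCount t (Metric.closedBall x r₀) with hk₀
  have hk₀pos : 0 < k₀ := by
    by_contra! h
    have hz : indicesIn t (Metric.closedBall x r₀) = ∅ :=
      Finset.card_eq_zero.1 (Nat.le_zero.1 h)
    have : labelSum t (Metric.closedBall x r₀) = 0 := by rw [labelSum, hz, Finset.sum_empty]
    rw [this, mul_zero] at hsig
    exact hsig.not_ge (by positivity)
  have hk₀n : k₀ ≤ n := (Finset.card_le_univ _).trans_eq (Fintype.card_fin n)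
  have hball : ∀ k, (kRadii t x k).Nonempty → empCount t (kBall t x k) = k := fun k hk =>
    (sInf_kRadii_mem t x hk).2
  have hne₀ : (kRadii t x k₀).Nonempty := ⟨r₀, hr₀, rfl⟩
  have hle₀ : sInf (kRadii t x k₀) ≤ r₀ := csInf_le ⟨0, fun _ hr => hr.1⟩ ⟨hr₀, rfl⟩
  -- The two balls are nested and hold equally many training points, hence the same ones.
  have hsum₀ : labelSum t (kBall t x k₀) = labelSum t (Metric.closedBall x r₀) := by
    have : indicesIn t (kBall t x k₀) = indicesIn t (Metric.closedBall x r₀) :=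
      Finset.eq_of_subset_of_card_le
        (indicesIn_mono t (Metric.closedBall_subset_closedBall hle₀)) (hball _ hne₀).ge
    rw [labelSum, this, labelSum]
  have hmem₀ : k₀ ∈ significant c d δ t x := by
    refine ⟨hk₀pos, hk₀n, hne₀, ?_⟩
    rw [width_lt_abs_empBias_iff t c d δ hk₀pos (hball _ hne₀), hsum₀, ← abs_intUnits_mul s]
    exact hsig.trans_le (le_abs_self _)
  have hne : (significant c d δ t x).Nonempty := ⟨k₀, hmem₀⟩
  rw [classifier, if_pos hne]
  congr 1
  set k := sInf (significant c d δ t x)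
  obtain ⟨hk, hkn, hkne, hkw⟩ : k ∈ significant c d δ t x := Nat.sInf_mem hne
  have hkle : k ≤ k₀ := Nat.sInf_le hmem₀
  have hk' : (0 : ℝ) < k := Nat.cast_pos.2 hk
  refine signLabel_eq ?_
  have hb : empBias t (kBall t x k) = labelSum t (kBall t x k) / k := by
    rw [empBias, hball k hkne, labelSum]
  rw [hb, ← mul_div_assoc]
  refine div_pos ?_ hk'
  rcases hkle.eq_or_lt with heq | hlt
  · rw [heq, hsum₀]
    exact lt_of_le_of_lt (by positivity) hsig
  · have hr : sInf (kRadii t x k) < r₀ := by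
      by_contra! h
      have h1 := empCount_closedBall_mono t x h
      have h2 : empCount t (Metric.closedBall x (sInf (kRadii t x k))) = k := hball k hkne
      omega
    have h1 := hsmall _ (sInf_kRadii_mem t x hkne).1 hr
    rw [width_lt_abs_empBias_iff t c d δ hk (hball k hkne), ← abs_intUnits_mul s] at hkw
    change -(((s : ℤ) : ℝ) * labelSum t (kBall t x k)) ≤ c * √(empCount t (kBall t x k) * _) at h1
    rw [hball k hkne] at h1
    rcases lt_abs.1 hkw with h | h
    · exact lt_of_le_of_lt (by positivity) h
    · exact absurd h h1.not_gt

end Classifier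

/-! ### Salient points on a typical sample -/

theorem le_real_closedBall_massRadius {X : Type*} [MetricSpace X] [MeasurableSpace X]
    [BorelSpace X] (μ : Measure X) [IsFiniteMeasure μ] {p : ℝ} {x : X}
    (h : ∃ r : ℝ, 0 ≤ r ∧ p ≤ μ.real (Metric.closedBall x r)) :
    p ≤ μ.real (Metric.closedBall x (massRadius μ p x)) := by
  have h1 : Tendsto (fun m : ℕ => μ.real (Metric.closedBall x
      (massRadius μ p x + 1 / ((m : ℝ) + 1)))) atTop
      (𝓝 (μ.real (Metric.closedBall x (massRadius μ p x)))) := by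
    rw [← iInter_closedBall_add x (massRadius μ p x)]
    exact (ENNReal.tendsto_toReal (measure_ne_top _ _)).comp
      (tendsto_measure_iInter_atTop
        (fun m => Metric.isClosed_closedBall.measurableSet.nullMeasurableSet)
        (antitone_closedBall_add x _) ⟨0, measure_ne_top _ _⟩)
  refine ge_of_tendsto' h1 fun m => ?_
  obtain ⟨r, hr, hlt⟩ := exists_lt_of_csInf_lt h
    (show massRadius μ p x < massRadius μ p x + 1 / ((m : ℝ) + 1) by
      linarith [Nat.one_div_pos_of_nat (α := ℝ) (n := m)])
  exact hr.2.trans (measureReal_mono (Metric.closedBall_subset_closedBall hlt.le))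

/-- Given two points, balls of radius 0 shatter a singleton. -/
theorem subsingleton_of_vcDim_ballFamily_eq_zero {X : Type*} [MetricSpace X]
    (h : vcDim (ballFamily X) = 0) : Subsingleton X := by
  classical
  refine ⟨fun a b => ?_⟩
  by_contra hab
  have hsh : Shatters (ballFamily X) {a} := by
    intro T hT
    rcases Finset.subset_singleton_iff.1 hT with rfl | rfl
    · exact ⟨Metric.closedBall b 0, ⟨b, 0, le_rfl, rfl⟩, by simpa using hab⟩
    · exact ⟨Metric.closedBall a 0, ⟨a, 0, le_rfl, rfl⟩, by simp⟩
  have h1 : ((Finset.card {a} : ℕ) : ℕ∞) ≤ vcDim (ballFamily X) :=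
    le_iSup₂ (f := fun (S : Finset X) (_ : Shatters (ballFamily X) S) => (S.card : ℕ∞)) _ hsh
  rw [h] at h1
  simp at h1

section Typical

variable {X : Type*} [MetricSpace X] [MeasurableSpace X] [BorelSpace X] {P : Measure (X × ℤˣ)}
  [IsProbabilityMeasure P] {η : X → ℝ} {n : ℕ} {t : Fin n → X × ℤˣ} {x : X} {L : ℝ}

theorem neg_labelSum_le_of_typical (hη : IsBias P η) {s : ℤˣ} {r c : ℝ} (hL : 0 < L)
    (ht : ∀ u : ℤˣ, IsTypical P L (Metric.closedBall x r ×ˢ {u}) t) (hc : 32 ≤ c)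
    (hs : 0 < P.fst (Metric.closedBall x r) →
      0 < ((s : ℤ) : ℝ) * setBias P.fst η (Metric.closedBall x r)) :
    -(((s : ℤ) : ℝ) * labelSum t (Metric.closedBall x r)) ≤
      c * √(empCount t (Metric.closedBall x r) * L) := by
  set B := Metric.closedBall x r
  have hB : MeasurableSet B := Metric.isClosed_closedBall.measurableSet
  have hM : P.real (B ×ˢ {-s}) ≤ P.real (B ×ˢ {s}) := by
    rw [← sub_nonneg, ← hη.mul_setIntegral hB s]
    -- A null ball has no bias to speak of, but both expected counts vanish and the weak inequality
    -- survives.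
    rcases eq_zero_or_pos (P.fst B) with h0 | hpos
    · rw [Measure.restrict_eq_zero.2 h0, integral_zero_measure, mul_zero]
    · have h1 := hs hpos
      have h2 : 0 < P.fst.real B := ENNReal.toReal_pos hpos.ne' (measure_ne_top _ _)
      rw [setBias, ← mul_div_assoc, lt_div_iff₀ h2, zero_mul] at h1
      exact h1.le
  have h := sub_le_of_typical (hits_nonneg (B ×ˢ {s}) t) (hits_nonneg (B ×ˢ {-s}) t)
    (by positivity) hL (ht s).2 (ht (-s)).1
    (mul_le_mul_of_nonneg_left hM (Nat.cast_nonneg n)) hc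
  rw [mul_labelSum, cast_empCount t B s, neg_sub]
  exact h

theorem lt_labelSum_of_typical (hη : IsBias P η) {s : ℤˣ} {r c γ p : ℝ} (hL : 0 < L)
    (ht : ∀ u : ℤˣ, IsTypical P L (Metric.closedBall x r ×ˢ {u}) t) (hc : 0 ≤ c) (hp : 0 < p)
    (hγ : 0 < γ) (hpB : p ≤ P.fst.real (Metric.closedBall x r))
    (hs : γ ≤ ((s : ℤ) : ℝ) * setBias P.fst η (Metric.closedBall x r))
    (hlarge : (81 + 2 * c) ^ 2 * L < n * (p * γ ^ 2)) :
    c * √(empCount t (Metric.closedBall x r) * L) <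
      ((s : ℤ) : ℝ) * labelSum t (Metric.closedBall x r) := by
  set B := Metric.closedBall x r
  have hB : MeasurableSet B := Metric.isClosed_closedBall.measurableSet
  have hadd := fst_real_eq_add (P := P) hB s
  rw [setBias, ← mul_div_assoc, le_div_iff₀ (hp.trans_le hpB), hη.mul_setIntegral hB s, hadd] at hs
  rw [mul_labelSum, cast_empCount t B s]
  refine lt_sub_of_typical (M₁ := n * P.real (B ×ˢ {s})) (M₂ := n * P.real (B ×ˢ {-s})) (γ := γ)
    (hits_nonneg _ _) (hits_nonneg _ _) (by positivity) (by positivity) hL (ht s) (ht (-s)).1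
    hγ ?_ hc ?_
  · have := mul_le_mul_of_nonneg_left hs (Nat.cast_nonneg (α := ℝ) n)
    linarith
  · refine hlarge.trans_le ?_
    rw [← mul_add, ← hadd]
    have : (n : ℝ) * (γ ^ 2 * p) ≤ n * (γ ^ 2 * P.fst.real B) := by gcongr
    linarith

theorem sign_and_bound_of_isSalient (hη : IsBias P η) {p γ : ℝ}
    (h : IsSalient P.fst η p γ x) : ∃ s : ℤˣ, 0 < ((s : ℤ) : ℝ) * η x ∧
      (∀ r : ℝ, 0 ≤ r → r < massRadius P.fst p x → 0 < P.fst (Metric.closedBall x r) →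
        0 < ((s : ℤ) : ℝ) * setBias P.fst η (Metric.closedBall x r)) ∧
      γ ≤ ((s : ℤ) : ℝ) * setBias P.fst η (Metric.closedBall x (massRadius P.fst p x)) ∧
      p * γ ^ 2 ≤ 1 := by
  obtain ⟨⟨hp, hp1, hγ⟩, hr, s, hs, hsx, hsr, hsγ⟩ := h
  obtain ⟨u, rfl⟩ : ∃ u : ℤˣ, s = ((u : ℤ) : ℝ) := by
    rcases hs with rfl | rfl
    · exact ⟨1, by simp⟩
    · exact ⟨-1, by simp⟩
  refine ⟨u, hsx, hsr, hsγ, ?_⟩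
  have hpB := le_real_closedBall_massRadius P.fst hr
  set B := Metric.closedBall x (massRadius P.fst p x)
  have hB : MeasurableSet B := Metric.isClosed_closedBall.measurableSet
  have hpos := hp.trans_le hpB
  have hadd := fst_real_eq_add (P := P) hB u
  rw [setBias, ← mul_div_assoc, le_div_iff₀ hpos, hη.mul_setIntegral hB u] at hsγ
  have hγ1 : γ ≤ 1 := by
    refine le_of_mul_le_mul_right (a := P.fst.real B) ?_ hpos
    linarith [measureReal_nonneg (μ := P) (s := B ×ˢ {-u})]
  calc p * γ ^ 2 ≤ 1 * 1 ^ 2 := by gcongr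
    _ = 1 := by norm_num

/-- The supremum need not be attained, so a pair beyond half of it is taken; the factor 2 is
absorbed in C. -/
theorem adv_le_one_and_exists_isSalient (hη : IsBias P η) (h : 0 < adv P.fst η x) :
    adv P.fst η x ≤ 1 ∧ ∃ p γ, IsSalient P.fst η p γ x ∧ adv P.fst η x < 2 * (p * γ ^ 2) := by
  set A := {a : ℝ | ∃ p γ : ℝ, IsSalient P.fst η p γ x ∧ a = p * γ ^ 2} with hA
  have hadv : adv P.fst η x = sSup A := by
    rw [adv]
    refine if_neg fun h0 => ?_
    rw [adv, if_pos h0] at h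
    exact h.false
  rw [hadv] at h ⊢
  have hne : A.Nonempty := by
    by_contra hempty
    rw [not_nonempty_iff_eq_empty.1 hempty, Real.sSup_empty] at h
    exact h.false
  refine ⟨csSup_le hne ?_, ?_⟩
  · rintro _ ⟨p, γ, hs, rfl⟩
    obtain ⟨-, -, -, -, h1⟩ := sign_and_bound_of_isSalient hη hs
    exact h1
  · obtain ⟨_, ⟨p, γ, hs, rfl⟩, hlt⟩ := exists_lt_of_lt_csSup hne (half_lt_self h)
    exact ⟨p, γ, hs, by linarith⟩

theorem classifier_eq_some_of_isSalient (hη : IsBias P η) {p γ c K δ : ℝ} {d : ℕ} {s : ℤˣ}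
    (hL : 0 < d * Real.log n + Real.log (1 / δ)) (hK : 1 ≤ K) (hd : d ≠ 0 → K = 1)
    (hX : d = 0 → Subsingleton X) (hc : 32 ≤ c)
    (ht : ∀ r : ℝ, 0 ≤ r → ∀ u : ℤˣ,
      IsTypical P (K * (d * Real.log n + Real.log (1 / δ))) (Metric.closedBall x r ×ˢ {u}) t)
    (h : IsSalient P.fst η p γ x)
    (hsr : ∀ r : ℝ, 0 ≤ r → r < massRadius P.fst p x → 0 < P.fst (Metric.closedBall x r) →
      0 < ((s : ℤ) : ℝ) * setBias P.fst η (Metric.closedBall x r))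
    (hsγ : γ ≤ ((s : ℤ) : ℝ) * setBias P.fst η (Metric.closedBall x (massRadius P.fst p x)))
    (hlarge : (81 + 2 * c) ^ 2 * (K * (d * Real.log n + Real.log (1 / δ))) < n * (p * γ ^ 2)) :
    classifier c d δ t x = some s := by
  set L := d * Real.log n + Real.log (1 / δ) with hLdef
  obtain ⟨⟨hp, -, hγ⟩, hex, -⟩ := h
  have hr₀ : 0 ≤ massRadius P.fst p x := Real.sInf_nonneg fun _ hr => hr.1
  have hKL : 0 < K * L := by positivity
  have hc0 : 0 ≤ c := by linarith
  have hbig := lt_labelSum_of_typical hη hKL (ht _ hr₀) hc0 hp hγ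
    (le_real_closedBall_massRadius P.fst hex) hsγ hlarge
  have hsig : c * √(empCount t (Metric.closedBall x (massRadius P.fst p x)) * L) <
      ((s : ℤ) : ℝ) * labelSum t (Metric.closedBall x (massRadius P.fst p x)) := by
    refine lt_of_le_of_lt ?_ hbig
    have : L ≤ K * L := le_mul_of_one_le_left hL.le hK
    gcongr
  refine classifier_eq_some t x hc0 hr₀ hsig fun r hr hlt => ?_
  -- Typicality at level K L with K > 1 would not match the classifier's width. For d = 0 this is
  -- harmless: the smaller ball equals the significant one, whose signed sum is positive.
  by_cases h0 : d = 0
  · have := hX h0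
    have huniv : ∀ r' : ℝ, 0 ≤ r' → Metric.closedBall x r' = univ := fun r' hr' =>
      eq_univ_of_forall fun z => by simpa [Subsingleton.elim z x] using hr'
    rw [huniv _ hr₀] at hsig
    rw [huniv r hr]
    have h1 : 0 ≤ c * √(empCount t (univ : Set X) * L) := by positivity
    linarith
  · rw [hd h0, one_mul] at ht
    exact neg_labelSum_le_of_typical hη hL (ht r hr) hc (hsr r hr hlt)

end Typical

/-! ### Numerical estimates -/

/-- For d ≥ 1 and n ≥ 8, both 8 ≤ nᵈ and 2n + 1 ≤ n², so the prefactor is at most n³ᵈ. For d = 0 it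
is just 8, at most exp (8 K l). -/
theorem failure_probability_le {n d : ℕ} {K l : ℝ} (hn : 8 ≤ n) (hl : 0 < l) (hK : 1 ≤ K)
    (hd : d = 0 → 1 ≤ K * l) :
    8 * (2 * n + 1) ^ d * Real.exp (-(9 * (K * (d * Real.log n + l)))) ≤ Real.exp (-l) := by
  have h8 : (8 : ℝ) ≤ n := by exact_mod_cast hn
  have hn0 : (0 : ℝ) < n := by linarith
  rcases Nat.eq_zero_or_pos d with rfl | hdpos
  · have h1 := hd rfl
    have h2 : (8 : ℝ) ≤ Real.exp (8 * (K * l)) := by linarith [Real.add_one_le_exp (8 * (K * l))]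
    calc 8 * (2 * (n : ℝ) + 1) ^ 0 * Real.exp (-(9 * (K * ((0 : ℕ) * Real.log n + l))))
        = 8 * Real.exp (-(9 * (K * l))) := by simp
      _ ≤ Real.exp (8 * (K * l)) * Real.exp (-(9 * (K * l))) := by gcongr
      _ = Real.exp (-(K * l)) := by rw [← Real.exp_add]; ring_nf
      _ ≤ Real.exp (-l) := by
          have : l ≤ K * l := le_mul_of_one_le_left hl.le hK
          gcongr
  · have hlog : 0 ≤ Real.log n := Real.log_nonneg (by linarith)
    have hd1 : (1 : ℝ) ≤ d := by exact_mod_cast hdpos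
    have he : Real.exp (d * Real.log n) = (n : ℝ) ^ d := by
      rw [mul_comm, ← Real.rpow_def_of_pos hn0, Real.rpow_natCast]
    have h1 : (2 * (n : ℝ) + 1) ^ d ≤ Real.exp (d * Real.log n) ^ 2 := by
      rw [he, ← pow_mul, mul_comm d 2, pow_mul]
      gcongr
      nlinarith
    have h2 : 8 ≤ Real.exp (d * Real.log n) := by
      rw [he]
      exact h8.trans (le_self_pow₀ (by linarith) hdpos.ne')
    have h3 : d * Real.log n + l ≤ K * (d * Real.log n + l) :=
      le_mul_of_one_le_left (by positivity) hK
    calc _ ≤ Real.exp (d * Real.log n) * Real.exp (d * Real.log n) ^ 2 *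
          Real.exp (-(9 * (d * Real.log n + l))) := by gcongr
      _ = Real.exp (-(6 * (d * Real.log n)) - 9 * l) := by
          rw [← Real.exp_nat_mul, ← Real.exp_add, ← Real.exp_add]
          congr 1
          push_cast
          ring
      _ ≤ Real.exp (-l) := by
          have : 0 ≤ d * Real.log n := by positivity
          gcongr
          linarith

/-- With u = n a, log n = log u + log (1/a) and log u ≤ 2√u. The first summand of C handles log
(1/a) and l; the second, using l ≥ l₁, forces u ≥ 16 H² + 16, whence H log u ≤ u/2. -/
theorem sample_size_sufficient {n d : ℕ} {W a l l₁ C : ℝ} (hW : 0 < W) (ha : 0 < a) (ha2 : a ≤ 1)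
    (hl₁ : 0 < l₁) (hl : l₁ ≤ l)
    (hC : C = 2 * (2 * W * (d + 1)) + (16 * (2 * W * (d + 1)) ^ 2 + 16) / l₁)
    (hn : C / a * max (Real.log (1 / a)) l ≤ n) :
    8 ≤ n ∧ 2 * (W * (d * Real.log n + l)) ≤ n * a := by
  set H := 2 * W * (d + 1) with hH
  have hHpos : 0 < H := by positivity
  have hCpos : 0 < C := by rw [hC]; positivity
  have hCH : 2 * H ≤ C := by
    rw [hC]
    have : 0 < (16 * H ^ 2 + 16) / l₁ := by positivity
    linarith
  have hCl : 16 * H ^ 2 + 16 ≤ C * l := by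
    have h1 : 16 * H ^ 2 + 16 ≤ C * l₁ := by
      rw [hC, add_mul, div_mul_cancel₀ _ hl₁.ne']
      have : 0 < 2 * H * l₁ := by positivity
      linarith
    exact h1.trans (by gcongr)
  set u := (n : ℝ) * a with hu
  have hmax : C * max (Real.log (1 / a)) l ≤ u := by
    have h1 := mul_le_mul_of_nonneg_right hn ha.le
    have h2 : C / a * max (Real.log (1 / a)) l * a = C * max (Real.log (1 / a)) l := by
      field_simp
    rwa [h2] at h1
  have hul : C * l ≤ u := le_trans (by gcongr; exact le_max_right _ _) hmax
  have hua : C * Real.log (1 / a) ≤ u := le_trans (by gcongr; exact le_max_left _ _) hmax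
  have hu16 : 16 * H ^ 2 + 16 ≤ u := hCl.trans hul
  have hupos : 0 < u := by nlinarith [sq_nonneg H]
  have hnu : u ≤ n := by
    rw [hu]
    exact mul_le_of_le_one_right (Nat.cast_nonneg n) ha2
  have hn8 : (8 : ℝ) ≤ n := by nlinarith [sq_nonneg H]
  refine ⟨by exact_mod_cast hn8, ?_⟩
  have hlogn : Real.log n = Real.log u + Real.log (1 / a) := by
    rw [hu, one_div, Real.log_inv, Real.log_mul (by linarith) ha.ne']
    ring
  set w := √u with hw
  have hw0 : 0 < w := Real.sqrt_pos.2 hupos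
  have hw2 : w ^ 2 = u := Real.sq_sqrt hupos.le
  have hlogu : Real.log u ≤ 2 * w := by
    rw [← hw2, Real.log_pow]
    have := Real.log_le_sub_one_of_pos hw0
    push_cast
    linarith
  have hwH : 4 * H ≤ w := by
    rw [hw]
    refine Real.le_sqrt_of_sq_le ?_
    nlinarith
  have hd0 : (0 : ℝ) ≤ d := Nat.cast_nonneg d
  have h2Hl : 2 * H * l ≤ u := le_trans (by gcongr; linarith) hul
  have h2Ha : 2 * H * Real.log (1 / a) ≤ u := by
    rcases le_total (Real.log (1 / a)) 0 with h | h
    · exact (mul_nonpos_of_nonneg_of_nonpos (by positivity) h).trans hupos.le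
    · exact le_trans (by gcongr) hua
  have hHw : 4 * H * w ≤ u := by
    rw [← hw2, sq]
    gcongr
  have hHn : H * Real.log n ≤ u := by
    rw [hlogn, mul_add]
    have := mul_le_mul_of_nonneg_left hlogu hHpos.le
    linarith
  have hHl : H * l ≤ u := by
    have : 0 ≤ H * l := mul_nonneg hHpos.le (hl₁.le.trans hl)
    linarith
  refine le_of_mul_le_mul_left ?_ hHpos
  calc H * (2 * (W * (d * Real.log n + l))) = 2 * W * (d * (H * Real.log n) + H * l) := by ring
    _ ≤ 2 * W * (d * u + u) := by gcongr
    _ = H * u := by rw [hH]; ring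

end AKNN

end

/-! ### Choice of constants and assembly -/

theorem theorem2 :
    ∃ c₀ : ℝ, 0 < c₀ ∧ ∀ c₁ : ℝ, c₀ ≤ c₁ →
    ∀ (d₀ : ℕ) (δ₁ : ℝ), δ₁ < 1 →
    ∃ C : ℝ, 0 < C ∧
    ∀ (X : Type*) [MetricSpace X] [TopologicalSpace.SeparableSpace X]
      [MeasurableSpace X] [BorelSpace X],
      AKNN.vcDim (AKNN.ballFamily X) = (d₀ : ℕ∞) →
    ∀ (P : Measure (X × ℤˣ)) [IsProbabilityMeasure P]
      (η : X → ℝ) (gstar : X → ℤˣ),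
      AKNN.IsBias P η → AKNN.IsBayesOptimal η gstar →
    ∀ (δ : ℝ), 0 < δ → δ ≤ δ₁ →
    ∀ n : ℕ,
    ∃ E : Set (Fin n → X × ℤˣ), MeasurableSet E ∧
      ENNReal.ofReal (1 - δ) ≤ Measure.pi (fun _ : Fin n => P) E ∧
      ∀ t ∈ E, ∀ x ∈ P.fst.support,
        0 < AKNN.adv P.fst η x →
        (n : ℝ) ≥ C / AKNN.adv P.fst η x *
          max (Real.log (1 / AKNN.adv P.fst η x)) (Real.log (1 / δ)) →
        AKNN.classifier c₁ d₀ δ t x = some (gstar x) := by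
  refine ⟨32, by norm_num, fun c₁ hc₁ d₀ δ₁ hδ₁ => ?_⟩
  rcases le_or_gt δ₁ 0 with hδ₁0 | hδ₁0
  · refine ⟨1, one_pos, ?_⟩
    intro X _ _ _ _ _ P _ η gstar _ _ δ hδ hδδ₁
    linarith
  set l₁ := Real.log (1 / δ₁) with hl₁def
  have hl₁ : 0 < l₁ := Real.log_pos (by rw [lt_div_iff₀ hδ₁0]; linarith)
  -- Symmetrization needs a level of at least 1. For d₀ > 0 the term d₀ log n supplies it; for d₀ =
  -- 0 only log (1/δ) ≥ l₁ is available and must be rescaled.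
  set K : ℝ := if d₀ = 0 then max 1 (1 / l₁) else 1 with hKdef
  have hK : 1 ≤ K := by
    rw [hKdef]; split_ifs
    · exact le_max_left _ _
    · exact le_rfl
  have hK1 : d₀ ≠ 0 → K = 1 := fun h => by rw [hKdef, if_neg h]
  have hK0 : d₀ = 0 → 1 ≤ K * l₁ := fun h => by
    rw [hKdef, if_pos h, ← div_le_iff₀ hl₁]
    exact le_max_right _ _
  set W := (81 + 2 * c₁) ^ 2 * K with hWdef
  have hW : 0 < W := by positivity
  refine ⟨2 * (2 * W * (d₀ + 1)) + (16 * (2 * W * (d₀ + 1)) ^ 2 + 16) / l₁, by positivity, ?_⟩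
  intro X _ _ _ _ hvc P _ η gstar hη hg δ hδ hδδ₁ n
  set l := Real.log (1 / δ) with hldef
  have hl : l₁ ≤ l := by
    rw [hl₁def, hldef]
    gcongr
  have hl0 : 0 < l := hl₁.trans_le hl
  have hXs : d₀ = 0 → Subsingleton X := fun h =>
    AKNN.subsingleton_of_vcDim_ballFamily_eq_zero (by rw [hvc, h, Nat.cast_zero])
  have hsize := fun (a : ℝ) (ha : 0 < a) (ha1 : a ≤ 1) =>
    AKNN.sample_size_sufficient (n := n) (d := d₀) hW ha ha1 hl₁ hl rfl
  -- The sample size condition forces n ≥ 8, so below that the claim is vacuous and the full event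
  -- serves.
  rcases lt_or_ge n 8 with hn8 | hn8
  · refine ⟨Set.univ, MeasurableSet.univ, ?_, ?_⟩
    · rw [measure_univ]
      exact ENNReal.ofReal_le_one.2 (by linarith)
    · intro t _ x _ hadv hn
      have h := (hsize _ hadv (AKNN.adv_le_one_and_exists_isSalient hη hadv).1 hn).1
      omega
  have hlogn : 0 ≤ d₀ * Real.log n := by positivity
  have hΛ : 1 ≤ K * (d₀ * Real.log n + l) := by
    rcases eq_or_ne d₀ 0 with h | h
    · have h1 : K * l₁ ≤ K * (d₀ * Real.log n + l) := by gcongr; linarith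
      exact (hK0 h).trans h1
    · have h1 : 1 ≤ Real.log n := by
        rw [Real.le_log_iff_exp_le (by positivity)]
        have : (8 : ℝ) ≤ n := by exact_mod_cast hn8
        linarith [Real.exp_one_lt_d9]
      have h2 : (1 : ℝ) ≤ d₀ := by exact_mod_cast Nat.one_le_iff_ne_zero.2 h
      rw [hK1 h]
      nlinarith
  obtain ⟨E, hEm, hEP, hE⟩ := AKNN.exists_event_isTypical hvc.le P n hΛ
  refine ⟨E, hEm, le_trans (ENNReal.ofReal_le_ofReal ?_) hEP, ?_⟩
  · have h1 := AKNN.failure_probability_le hn8 hl0 hK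
      fun h => (hK0 h).trans (by gcongr : K * l₁ ≤ K * l)
    have h2 : Real.exp (-l) = δ := by
      rw [hldef, one_div, Real.log_inv, neg_neg, Real.exp_log hδ]
    linarith
  · intro t ht x _ hadv hn
    obtain ⟨ha1, p, γ, hs, hlt⟩ := AKNN.adv_le_one_and_exists_isSalient hη hadv
    have hbound := (hsize _ hadv ha1 hn).2
    obtain ⟨s, hsx, hsr, hsγ, -⟩ := AKNN.sign_and_bound_of_isSalient hη hs
    have hgx : gstar x = s := by
      rw [hg x fun h => by rw [h, mul_zero] at hsx; exact hsx.false]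
      exact AKNN.signLabel_eq hsx
    rw [hgx]
    refine AKNN.classifier_eq_some_of_isSalient hη (by positivity) hK hK1 hXs hc₁ (ht := hE t ht x)
      hs hsr hsγ ?_
    have hn0 : (0 : ℝ) < n := by positivity
    -- The 2 lost in passing to (p, γ) cancels the 2 on the left of `hbound`.
    have h1 : (n : ℝ) * AKNN.adv P.fst η x < n * (2 * (p * γ ^ 2)) := by gcongr
    rw [hWdef] at hbound
    linarith
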